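/- Setting. For partial multivalued functions $f,g :\subseteq \{0,1\}^{\mathbb N} \rightrightarrows \{0,1\}^{\mathbb N}$, write $f \le_W g$ if there are computable partial functions $H, K$ such that for all $x \in \mathrm{dom}(f)$ we have $H(x) \in \mathrm{dom}(g)$, and $K(x,y)$ is defined with $K(x,y) \in f(x)$ for all $y \in g(H(x))$. The equivalence classes are the Weihrauch degrees. A degree is pointed if its representatives have a computable instance; $\mathfrak W_\bullet$ is the set of pointed degrees. The operations are induced by the following operations on multivalued functions, where $\langle\cdot,\cdot\rangle$ is the standard pairing: $1 = \mathrm{id}$; $f \sqcap g$ maps $\langle q_0,q_1\rangle$ with $q_0\in\mathrm{dom}(f)$, $q_1\in\mathrm{dom}(g)$ to all $0p$ with $p\in f(q_0)$ and all $1p$ with $p\in g(q_1)$; $f\sqcup g$ maps $0q$ to all $0p$ with $p\in f(q)$ and $1q$ to all $1p$ with $p\in g(q)$; $f\times g$ maps $\langle q_0,q_1\rangle$ to all $\langle p_0,p_1\rangle$ with $p_0\in f(q_0)$, $p_1\in g(q_1)$; and $f^*$ maps $1q$ to $0^\omega$, and $0^{n+1}1\langle q_0,q_1\rangle$ to all $\langle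 p_0,p_1\rangle$ with $p_0\in f(q_0)$, $p_1\in f^*(0^n1q_1)$. Axioms are Horn clauses $\bigwedge_{i<k} t_i \le u_i \Rightarrow t \le u$ between terms in countably many variables; an axiom $t = u$ stands for $t \le u$ and $u \le t$. An inequality is derivable from a set of axioms if it is obtained from substitution instances of the axioms by means of reflexivity and transitivity of $\le$ and monotonicity of all operations of the signature. It is universally valid if it holds for every interpretation of the variables by pointed Weihrauch degrees. A set of axioms is complete if every universally valid inequality between terms of the signature is derivable from it, and sound if each of its axioms holds in $\mathfrak W_\bullet$ for every interpretation of the variables by pointed degrees. Let $\Delta$ consist of the following axioms. Joins: $a \le a\sqcup b$; $b \le a \sqcup b$; $b \le a \wedge c \le a \Rightarrow b\sqcup c\le a$; $a\sqcap(b\sqcup c) = (a\sqcap b)\sqcup(a\sqcap c)$; $a\times(b\sqcup c) = (a\times b)\sqcup(a\times c)$. Parallelization: $a\le a^*$; $(a^*)^*\le a^*$; $a^*\times a^*\le a^*$; $(a\sqcup b)^* = a^*\times b^*$; $(a\sqcap b)^* = a^*\sqcap b^*$; $(a\times b)^* = 1\sqcup (a\times a^*\times b\times b^*)$; $1^* =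 1$. Proposition. Let $\Gamma$ be a complete set of axioms for $(\mathfrak W_\bullet,\sqcap,\times,1)$. Then $\Gamma\cup\Delta$ is a complete set of axioms for $(\mathfrak W_\bullet,\sqcap,\times,1,\sqcup,(-)^*)$. Moreover, if $\Gamma$ is sound, then so is $\Gamma\cup\Delta$. -/

import Mathlib

namespace Weihrauch

/-! ### Cantor space and computable partial functions on it -/

/-- Cantor space `{0,1}^ℕ`, with `false` for `0` and `true` for `1`. -/
abbrev Cantor : Type := ℕ → Bool

namespace Cantor

/-- The finite initial segment `x 0, …, x (n - 1)`. -/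
def take (x : Cantor) (n : ℕ) : List Bool := (List.range n).map x

/-- The sequence `b x`, that is, `x` with the letter `b` put in front. -/
def cons (b : Bool) (x : Cantor) : Cantor
  | 0 => b
  | n + 1 => x n

/-- The sequence `0ⁿ 1 x`. -/
def tagged (n : ℕ) (x : Cantor) : Cantor := (cons false)^[n] (cons true x)

/-- The standard pairing `⟨x, y⟩ = x 0, y 0, x 1, y 1, …`. -/
def pair (x y : Cantor) : Cantor := fun n => if n % 2 = 0 then x (n / 2) else y (n / 2)

/-- First component of a pair; every sequence is `⟨fst z, snd z⟩`. -/
def fst (z : Cantor) : Cantor := fun n => z (2 * n)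

/-- Second component of a pair. -/
def snd (z : Cantor) : Cantor := fun n => z (2 * n + 1)

theorem pair_fst_snd (z : Cantor) : pair (fst z) (snd z) = z := by
  funext n
  unfold pair fst snd
  split_ifs <;> (congr 1; omega)

theorem fst_pair (x y : Cantor) : fst (pair x y) = x := by
  funext n
  simp [pair, fst]

theorem snd_pair (x y : Cantor) : snd (pair x y) = y := by
  funext n
  have h : (2 * n + 1) / 2 = n := by omega
  simp [pair, snd, h]

end Cantor

/-- A partial function on Cantor space is computable if some computable monotone function on
finite words approximates it: reading longer and longer initial segments of an argument `x` in
the domain, the words put out are longer and longer initial segments of the value.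
(By monotonicity, all words put out on initial segments of `x` are then prefixes of the value.) -/
def ComputableFun (F : Cantor →. Cantor) : Prop :=
  ∃ w : List Bool → List Bool, Computable w ∧
    (∀ σ τ : List Bool, σ <+: τ → w σ <+: w τ) ∧
    ∀ x y : Cantor, y ∈ F x → ∀ n : ℕ, ∃ k : ℕ, y.take n <+: w (x.take k)

/-! ### Multivalued functions and Weihrauch reducibility -/

/-- Partial multivalued functions on Cantor space: `f x` is the set of values at `x`. -/
abbrev MultiFun : Type := Cantor → Set Cantor

namespace MultiFun

/-- The domain: the arguments that have a value. -/
def dom (f : MultiFun) : Set Cantor := {x | (f x).Nonempty}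

/-- Weihrauch reducibility `f ≤_W g`. Functions of two arguments are computable if they are so
as functions of the paired argument. -/
def Reducible (f g : MultiFun) : Prop :=
  ∃ H K : Cantor →. Cantor, ComputableFun H ∧ ComputableFun K ∧
    ∀ x ∈ f.dom, ∃ h ∈ H x, h ∈ g.dom ∧
      ∀ y ∈ g h, ∃ z ∈ K (Cantor.pair x y), z ∈ f x

/-- `f` is pointed if it has a computable instance. -/
def Pointed (f : MultiFun) : Prop := ∃ x ∈ f.dom, Computable x

/-- The constant `1`: the identity. -/
def one : MultiFun := fun x => {x}

/-- The meet `f ⊓ g`: given an instance of `f` and an instance of `g`, solve one of the two and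
say which. -/
def meet (f g : MultiFun) : MultiFun := fun x =>
  {y | x.fst ∈ f.dom ∧ x.snd ∈ g.dom ∧
    ((∃ p ∈ f x.fst, y = Cantor.cons false p) ∨ (∃ p ∈ g x.snd, y = Cantor.cons true p))}

/-- The join `f ⊔ g`: given an instance of `f` or of `g`, solve it. -/
def join (f g : MultiFun) : MultiFun := fun x =>
  {y | (∃ q, ∃ p ∈ f q, x = Cantor.cons false q ∧ y = Cantor.cons false p) ∨
    (∃ q, ∃ p ∈ g q, x = Cantor.cons true q ∧ y = Cantor.cons true p)}

/-- The product `f × g`: given an instance of `f` and an instance of `g`, solve both. -/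
def prod (f g : MultiFun) : MultiFun := fun x =>
  {y | ∃ p₀ ∈ f x.fst, ∃ p₁ ∈ g x.snd, y = Cantor.pair p₀ p₁}

/-- Solving `n` instances of `f`, given as `⟨q₁, ⟨q₂, … ⟨qₙ, q⟩ … ⟩⟩`; the solution ends in `0^ω`. -/
def power (f : MultiFun) : ℕ → MultiFun
  | 0 => fun _ => {fun _ => false}
  | n + 1 => prod f (power f n)

/-- The finite parallelization `f*`: given `0ⁿ 1 q`, where `q` lists `n` instances of `f`,
solve them all. -/
def star (f : MultiFun) : MultiFun := fun x =>
  {y | ∃ n q, x = Cantor.tagged n q ∧ y ∈ power f n q}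

end MultiFun

/-! ### Inequalities and Horn clauses -/

/-- A Horn clause `⋀ᵢ tᵢ ≤ uᵢ ⇒ t ≤ u` over a type `T` of terms. -/
structure HornClause (T : Type) where
  /-- The pairs `(tᵢ, uᵢ)`. -/
  premises : List (T × T)
  /-- The term `t`. -/
  lhs : T
  /-- The term `u`. -/
  rhs : T

namespace HornClause

/-- Apply a translation of terms to all terms in a clause. -/
def map {S T : Type} (e : S → T) (c : HornClause S) : HornClause T :=
  ⟨c.premises.map (Prod.map e e), e c.lhs, e c.rhs⟩

/-- The axiom `t ≤ u`. -/
def ineq {T : Type} (t u : T) : HornClause T := ⟨[], t, u⟩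

/-- The axiom `t = u`, that is, the two inequalities. -/
def equation {T : Type} (t u : T) : Set (HornClause T) := {ineq t u, ineq u t}

end HornClause

/-! ### The signature `(⊓, ×, 1)` -/

/-- Terms over `(⊓, ×, 1)`, with variables indexed by `ℕ`. -/
inductive BaseTerm : Type
  | var : ℕ → BaseTerm
  | one : BaseTerm
  | meet : BaseTerm → BaseTerm → BaseTerm
  | prod : BaseTerm → BaseTerm → BaseTerm

namespace BaseTerm

/-- Simultaneous substitution of terms for variables. -/
def subst (σ : ℕ → BaseTerm) : BaseTerm → BaseTerm
  | var n => σ n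
  | one => one
  | meet t u => meet (t.subst σ) (u.subst σ)
  | prod t u => prod (t.subst σ) (u.subst σ)

/-- The interpretation of a term, given representatives of the degrees of the variables. -/
def interp (ρ : ℕ → MultiFun) : BaseTerm → MultiFun
  | var n => ρ n
  | one => MultiFun.one
  | meet t u => MultiFun.meet (t.interp ρ) (u.interp ρ)
  | prod t u => MultiFun.prod (t.interp ρ) (u.interp ρ)

/-- The inequality `t ≤ u` is universally valid in the pointed Weihrauch degrees. -/
def Valid (t u : BaseTerm) : Prop :=
  ∀ ρ : ℕ → MultiFun, (∀ n, (ρ n).Pointed) → MultiFun.Reducible (t.interp ρ) (u.interp ρ)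

/-- A Horn clause holds in the pointed Weihrauch degrees. -/
def ClauseValid (c : HornClause BaseTerm) : Prop :=
  ∀ ρ : ℕ → MultiFun, (∀ n, (ρ n).Pointed) →
    (∀ p ∈ c.premises, MultiFun.Reducible (p.1.interp ρ) (p.2.interp ρ)) →
    MultiFun.Reducible (c.lhs.interp ρ) (c.rhs.interp ρ)

/-- Derivability of `t ≤ u` from a set of Horn clauses: inequality is reflexive and transitive, all
operations are monotone, and every substitution instance of a clause may be used as a rule. -/
inductive Derivable (Γ : Set (HornClause BaseTerm)) : BaseTerm → BaseTerm → Prop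
  | refl (t) : Derivable Γ t t
  | trans {t u v} : Derivable Γ t u → Derivable Γ u v → Derivable Γ t v
  | meet_mono {t t' u u'} : Derivable Γ t t' → Derivable Γ u u' →
      Derivable Γ (meet t u) (meet t' u')
  | prod_mono {t t' u u'} : Derivable Γ t t' → Derivable Γ u u' →
      Derivable Γ (prod t u) (prod t' u')
  | clause (c : HornClause BaseTerm) (hc : c ∈ Γ) (σ : ℕ → BaseTerm) :
      (∀ p ∈ c.premises, Derivable Γ (p.1.subst σ) (p.2.subst σ)) →
      Derivable Γ (c.lhs.subst σ) (c.rhs.subst σ)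

/-- All axioms in `Γ` hold in the pointed Weihrauch degrees. -/
def Sound (Γ : Set (HornClause BaseTerm)) : Prop := ∀ c ∈ Γ, ClauseValid c

/-- Every universally valid inequality is derivable from `Γ`. -/
def Complete (Γ : Set (HornClause BaseTerm)) : Prop :=
  ∀ t u : BaseTerm, Valid t u → Derivable Γ t u

end BaseTerm

/-! ### The signature `(⊓, ×, 1, ⊔, (-)*)` -/

/-- Terms over `(⊓, ×, 1, ⊔, (-)*)`, with variables indexed by `ℕ`. -/
inductive ExtTerm : Type
  | var : ℕ → ExtTerm
  | one : ExtTerm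
  | meet : ExtTerm → ExtTerm → ExtTerm
  | prod : ExtTerm → ExtTerm → ExtTerm
  | join : ExtTerm → ExtTerm → ExtTerm
  | star : ExtTerm → ExtTerm

/-- Terms over `(⊓, ×, 1)` are terms over `(⊓, ×, 1, ⊔, (-)*)`. -/
def BaseTerm.toExt : BaseTerm → ExtTerm
  | .var n => .var n
  | .one => .one
  | .meet t u => .meet t.toExt u.toExt
  | .prod t u => .prod t.toExt u.toExt

namespace ExtTerm

/-- Simultaneous substitution of terms for variables. -/
def subst (σ : ℕ → ExtTerm) : ExtTerm → ExtTerm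
  | var n => σ n
  | one => one
  | meet t u => meet (t.subst σ) (u.subst σ)
  | prod t u => prod (t.subst σ) (u.subst σ)
  | join t u => join (t.subst σ) (u.subst σ)
  | star t => star (t.subst σ)

/-- The interpretation of a term, given representatives of the degrees of the variables. -/
def interp (ρ : ℕ → MultiFun) : ExtTerm → MultiFun
  | var n => ρ n
  | one => MultiFun.one
  | meet t u => MultiFun.meet (t.interp ρ) (u.interp ρ)
  | prod t u => MultiFun.prod (t.interp ρ) (u.interp ρ)
  | join t u => MultiFun.join (t.interp ρ) (u.interp ρ)
  | star t => MultiFun.star (t.interp ρ)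

/-- The inequality `t ≤ u` is universally valid in the pointed Weihrauch degrees. -/
def Valid (t u : ExtTerm) : Prop :=
  ∀ ρ : ℕ → MultiFun, (∀ n, (ρ n).Pointed) → MultiFun.Reducible (t.interp ρ) (u.interp ρ)

/-- A Horn clause holds in the pointed Weihrauch degrees. -/
def ClauseValid (c : HornClause ExtTerm) : Prop :=
  ∀ ρ : ℕ → MultiFun, (∀ n, (ρ n).Pointed) →
    (∀ p ∈ c.premises, MultiFun.Reducible (p.1.interp ρ) (p.2.interp ρ)) →
    MultiFun.Reducible (c.lhs.interp ρ) (c.rhs.interp ρ)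

/-- Derivability of `t ≤ u` from a set of Horn clauses: inequality is reflexive and transitive, all
operations are monotone, and every substitution instance of a clause may be used as a rule. -/
inductive Derivable (Γ : Set (HornClause ExtTerm)) : ExtTerm → ExtTerm → Prop
  | refl (t) : Derivable Γ t t
  | trans {t u v} : Derivable Γ t u → Derivable Γ u v → Derivable Γ t v
  | meet_mono {t t' u u'} : Derivable Γ t t' → Derivable Γ u u' →
      Derivable Γ (meet t u) (meet t' u')
  | prod_mono {t t' u u'} : Derivable Γ t t' → Derivable Γ u u' →
      Derivable Γ (prod t u) (prod t' u')
  | join_mono {t t' u u'} : Derivable Γ t t' → Derivable Γ u u' →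
      Derivable Γ (join t u) (join t' u')
  | star_mono {t t'} : Derivable Γ t t' → Derivable Γ (star t) (star t')
  | clause (c : HornClause ExtTerm) (hc : c ∈ Γ) (σ : ℕ → ExtTerm) :
      (∀ p ∈ c.premises, Derivable Γ (p.1.subst σ) (p.2.subst σ)) →
      Derivable Γ (c.lhs.subst σ) (c.rhs.subst σ)

/-- All axioms in `Γ` hold in the pointed Weihrauch degrees. -/
def Sound (Γ : Set (HornClause ExtTerm)) : Prop := ∀ c ∈ Γ, ClauseValid c

/-- Every universally valid inequality is derivable from `Γ`. -/
def Complete (Γ : Set (HornClause ExtTerm)) : Prop :=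
  ∀ t u : ExtTerm, Valid t u → Derivable Γ t u

/-- The axioms for joins, in variables `a`, `b`, `c`: `⊔` is the least upper bound, and `⊓` and `×`
distribute over it. -/
def joinAxioms : Set (HornClause ExtTerm) :=
  let a := var 0
  let b := var 1
  let c := var 2
  {HornClause.ineq a (join a b), HornClause.ineq b (join a b)} ∪
  {⟨[(b, a), (c, a)], join b c, a⟩} ∪
  HornClause.equation (meet a (join b c)) (join (meet a b) (meet a c)) ∪
  HornClause.equation (prod a (join b c)) (join (prod a b) (prod a c))

/-- The axioms for parallelization, in variables `a`, `b`. -/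
def starAxioms : Set (HornClause ExtTerm) :=
  let a := var 0
  let b := var 1
  {HornClause.ineq a (star a), HornClause.ineq (star (star a)) (star a)} ∪
  {HornClause.ineq (prod (star a) (star a)) (star a)} ∪
  HornClause.equation (star (join a b)) (prod (star a) (star b)) ∪
  HornClause.equation (star (meet a b)) (meet (star a) (star b)) ∪
  HornClause.equation (star (prod a b))
    (join one (prod (prod (prod a (star a)) b) (star b))) ∪
  HornClause.equation (star one) one

end ExtTerm

end Weihrauch

/-! A term over `(⊓, ×, 1)` can be read combinatorially. An instance puts a question at each
occurrence of a variable, and a solution answers some set of occurrences that suffices for the term.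
`Comb t u` says that the occurrences of `u` can be sent to equally labelled occurrences of `t` in
such a way that enough answers for `u` are enough answers for `t`. Such an inequality holds for all
multivalued functions (`Comb.uRed`).

Completeness. The axioms for parallelization push stars down to the variables, and distributivity
pulls joins to the outside. So every term is derivably equal to a finite join of terms over `(⊓, ×,
1)` in letters `v` and `v*` (`hasNormalForm`). Since `⊔` is the least upper bound, it remains to
derive a valid inequality `s ≤ a` between one such term and a join.

To analyse it, interpret `v` by the function whose `i`-th question has the single answer `Z ⟨v, i⟩`,
where each `Z k` fails to be computable from some sequence that computes all the others; Baire
category supplies these (`exists_independent`). Ask pairwise different questions at the occurrences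
in `s`, and at each starred occurrence more questions than any joined term has occurrences. The
reduction ends in one joined term `s'`, and by independence a solution of `s` contains only answers
that were obtained through `s'`. An unstarred occurrence of `s'` obtains at most one answer, so by
the pigeonhole principle some copy of the questions is not touched by any of them. Hence an
unstarred occurrence of `s'` covers at most one occurrence of `s`, with the same label, while `v*`
in `s'` may cover several occurrences of `v` and `v*` (`exists_cover`).

Replacing each `v*` in `s'` by the finite product of the letters it covers gives `u` with `Comb s
u`. This is a valid inequality over `(⊓, ×, 1)`, hence derivable from `Γ`. The inequality `u ≤ s'`
follows from `1 ≤ a`, `a ≤ a*` and `a* × a* ≤ a*` (`exists_le_ofBase`).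

Soundness. A reduction that is uniform in `n` can be iterated as often as a tag prescribes
(`sigma_reducible`). It follows that `f*` is least among the `g` with `1 ≤ g` and `f × g ≤ g`
(`star_reducible`), and the axioms for parallelization come from this or from a similar iteration.
-/

namespace Weihrauch

/-! ### Tags and initial segments of sequences -/

namespace Cantor

/-- All letters but the first. -/
def tail (x : Cantor) : Cantor := fun n => x (n + 1)

/-- The sequence `0^ω`. -/
def zero : Cantor := fun _ => false

/-- The number `n` in `0ⁿ 1 x`. -/
noncomputable def tagCount (x : Cantor) : ℕ := sInf {n | x n = true}

/-- The sequence `x` in `0ⁿ 1 x`. -/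
noncomputable def untag (x : Cantor) : Cantor := tail^[tagCount x + 1] x

@[simp] theorem cons_zero (b : Bool) (x : Cantor) : cons b x 0 = b := rfl

@[simp] theorem tail_cons (b : Bool) (x : Cantor) : tail (cons b x) = x := rfl

theorem cons_tail (x : Cantor) : cons (x 0) (tail x) = x := by
  funext n; cases n <;> rfl

attribute [simp] pair_fst_snd fst_pair snd_pair

theorem cons_injective {b c : Bool} {x y : Cantor} (h : cons b x = cons c y) : b = c ∧ x = y :=
  ⟨congrFun h 0, congrArg tail h⟩

theorem tagged_succ (n : ℕ) (x : Cantor) : tagged (n + 1) x = cons false (tagged n x) :=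
  Function.iterate_succ_apply' _ _ _

theorem tagged_apply_lt {n k : ℕ} (x : Cantor) (h : k < n) : tagged n x k = false := by
  induction n generalizing k with
  | zero => omega
  | succ n ih =>
    rw [tagged_succ]
    cases k with
    | zero => rfl
    | succ k => exact ih (by omega)

theorem tagged_apply_self (n : ℕ) (x : Cantor) : tagged n x n = true := by
  induction n with
  | zero => rfl
  | succ n ih => rw [tagged_succ]; exact ih

@[simp] theorem tagCount_tagged (n : ℕ) (x : Cantor) : tagCount (tagged n x) = n := by
  apply le_antisymm
  · exact Nat.sInf_le (tagged_apply_self n x)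
  · refine le_csInf ⟨n, tagged_apply_self n x⟩ fun k hk => ?_
    by_contra hlt
    have := tagged_apply_lt x (not_le.1 hlt)
    simp_all

theorem tail_iterate_tagged (n : ℕ) (x : Cantor) : tail^[n + 1] (tagged n x) = x := by
  induction n with
  | zero => rfl
  | succ n ih => rw [tagged_succ, Function.iterate_succ_apply]; exact ih

@[simp] theorem untag_tagged (n : ℕ) (x : Cantor) : untag (tagged n x) = x := by
  rw [untag, tagCount_tagged, tail_iterate_tagged]

@[simp] theorem length_take (x : Cantor) (n : ℕ) : (x.take n).length = n := by simp [take]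

theorem getElem?_take {x : Cantor} {n i : ℕ} (h : i < n) : (x.take n)[i]? = some (x i) := by
  simp [take, h]

theorem take_prefix_iff {x : Cantor} {n : ℕ} {l : List Bool} :
    x.take n <+: l ↔ ∀ i < n, l[i]? = some (x i) := by
  rw [List.prefix_iff_getElem?]
  simp [take]

theorem take_prefix_take (x : Cantor) {m n : ℕ} (h : m ≤ n) : x.take m <+: x.take n :=
  take_prefix_iff.2 fun _ hi => getElem?_take (hi.trans_le h)

end Cantor

open Cantor

/-! ### Functionals given by word functions -/

/-- Word functions that respect prefixes. -/
def WordMono (w : List Bool → List Bool) : Prop := ∀ σ τ : List Bool, σ <+: τ → w σ <+: w τ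

/-- On the initial segments of `x`, the word function `w` puts out longer and longer initial
segments of `y`. -/
def Traces (w : List Bool → List Bool) (x y : Cantor) : Prop :=
  ∀ n : ℕ, ∃ k : ℕ, y.take n <+: w (x.take k)

/-- The total function `F` is computable when restricted to `D`. -/
def CompOn (D : Set Cantor) (F : Cantor → Cantor) : Prop :=
  ∃ w : List Bool → List Bool, Computable w ∧ WordMono w ∧ ∀ x ∈ D, Traces w x (F x)

theorem prefix_of_getElem? {l l' : List Bool}
    (h : ∀ (i : ℕ) (b : Bool), l[i]? = some b → l'[i]? = some b) : l <+: l' :=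
  List.prefix_iff_getElem?.2 fun i hi => h i _ (List.getElem?_eq_getElem hi)

theorem getElem?_of_prefix {l l' : List Bool} (h : l <+: l') {i : ℕ} {b : Bool}
    (hb : l[i]? = some b) : l'[i]? = some b := by
  obtain ⟨hi, rfl⟩ := List.getElem?_eq_some_iff.1 hb
  exact List.prefix_iff_getElem?.1 h i hi

theorem WordMono.comp {v w : List Bool → List Bool} (hv : WordMono v) (hw : WordMono w) :
    WordMono (v ∘ w) := fun _ _ h => hv _ _ (hw _ _ h)

theorem WordMono.iterate {w : List Bool → List Bool} (hw : WordMono w) (n : ℕ) :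
    WordMono w^[n] := by
  induction n with
  | zero => exact fun _ _ h => h
  | succ n ih => rw [Function.iterate_succ]; exact ih.comp hw

theorem WordMono.take_prefix {w : List Bool → List Bool} (hw : WordMono w) {x : Cantor} {k m : ℕ}
    (h : k ≤ m) : w (x.take k) <+: w (x.take m) := hw _ _ (x.take_prefix_take h)

theorem Traces.comp {v w : List Bool → List Bool} {x y z : Cantor} (hw : Traces w x y)
    (hv : Traces v y z) (hvm : WordMono v) : Traces (v ∘ w) x z := fun n => by
  obtain ⟨k, hk⟩ := hv n
  obtain ⟨m, hm⟩ := hw k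
  exact ⟨m, hk.trans (hvm _ _ hm)⟩

theorem Traces.apply {w : List Bool → List Bool} {x y : Cantor} (h : Traces w x y) (i : ℕ) :
    ∃ k, (w (x.take k))[i]? = some (y i) := by
  obtain ⟨k, hk⟩ := h (i + 1)
  exact ⟨k, take_prefix_iff.1 hk i (Nat.lt_succ_self i)⟩

/-- Letterwise convergence is enough: by monotonicity the largest of finitely many stages serves all
letters below `n`. -/
theorem Traces.of_apply {w : List Bool → List Bool} (hw : WordMono w) {x y : Cantor}
    (h : ∀ i, ∃ k, (w (x.take k))[i]? = some (y i)) : Traces w x y := fun n => by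
  choose k hk using h
  refine ⟨(Finset.range n).sup k, take_prefix_iff.2 fun i hi => ?_⟩
  exact getElem?_of_prefix (hw.take_prefix (Finset.le_sup (Finset.mem_range.2 hi))) (hk i)

/-! ### Closure properties of computable functionals -/

namespace CompOn

theorem mono {D E : Set Cantor} {F : Cantor → Cantor} (h : CompOn E F) (hDE : D ⊆ E) :
    CompOn D F := by
  obtain ⟨w, hc, hm, hw⟩ := h
  exact ⟨w, hc, hm, fun x hx => hw x (hDE hx)⟩

theorem congr {D : Set Cantor} {F G : Cantor → Cantor} (h : CompOn D F)
    (hFG : ∀ x ∈ D, F x = G x) : CompOn D G := by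
  obtain ⟨w, hc, hm, hw⟩ := h
  exact ⟨w, hc, hm, fun x hx => hFG x hx ▸ hw x hx⟩

theorem id (D : Set Cantor) : CompOn D fun x => x :=
  ⟨fun σ => σ, Computable.id, fun _ _ h => h, fun _ _ n => ⟨n, List.prefix_rfl⟩⟩

theorem comp {D E : Set Cantor} {F G : Cantor → Cantor} (hG : CompOn E G) (hF : CompOn D F)
    (h : ∀ x ∈ D, F x ∈ E) : CompOn D fun x => G (F x) := by
  obtain ⟨v, hvc, hvm, hv⟩ := hG
  obtain ⟨w, hwc, hwm, hw⟩ := hF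
  exact ⟨v ∘ w, hvc.comp hwc, hvm.comp hwm, fun x hx => (hw x hx).comp (hv _ (h x hx)) hvm⟩

/-- By the bound on `φ`, a word of length `ℓ` already determines the first `ℓ / 2` letters of the
output. -/
theorem reindex {φ : ℕ → ℕ} (hφ : Primrec φ) (hle : ∀ n, φ n ≤ 2 * n + 1) (D : Set Cantor) :
    CompOn D fun x n => x (φ n) := by
  have key : ∀ (σ : List Bool) (n : ℕ),
      ((List.range (σ.length / 2)).map fun n => σ.getD (φ n) false)[n]? =
        if n < σ.length / 2 then some (σ.getD (φ n) false) else none := by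
    intro σ n
    by_cases h : n < σ.length / 2 <;> simp [h]
  have hm : WordMono fun σ => (List.range (σ.length / 2)).map fun n => σ.getD (φ n) false := by
    intro σ τ h
    refine prefix_of_getElem? fun i b hb => ?_
    simp only [key] at hb ⊢
    split_ifs at hb with hi
    have hle' := hle i
    have hlen := h.length_le
    have h1 : φ i < σ.length := by omega
    rw [if_pos (by omega), ← hb]
    have := List.prefix_iff_getElem?.1 h (φ i) h1
    rw [List.getD_eq_getElem?_getD, this, List.getD_eq_getElem _ _ h1]
    rfl
  refine ⟨_, Primrec.to_comp ?_, hm, fun x _ => Traces.of_apply hm fun i => ?_⟩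
  · refine Primrec.list_map (Primrec.list_range.comp
      (Primrec.nat_div.comp Primrec.list_length (Primrec.const 2))) ?_
    exact (Primrec.list_getD false).comp Primrec.fst (hφ.comp Primrec.snd)
  · refine ⟨2 * i + 2, ?_⟩
    have := hle i
    rw [key, if_pos (by simp), List.getD_eq_getElem?_getD, getElem?_take (by omega)]
    rfl

theorem fst' (D : Set Cantor) : CompOn D Cantor.fst :=
  reindex (φ := fun n => 2 * n) (Primrec.nat_mul.comp (Primrec.const 2) Primrec.id)
    (fun n => by omega) D

theorem snd' (D : Set Cantor) : CompOn D Cantor.snd :=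
  reindex (φ := fun n => 2 * n + 1)
    (Primrec.succ.comp (Primrec.nat_mul.comp (Primrec.const 2) Primrec.id)) (fun _ => le_rfl) D

theorem tail' (D : Set Cantor) : CompOn D Cantor.tail :=
  reindex (φ := fun n => n + 1) Primrec.succ (fun n => by omega) D

theorem cons' (b : Bool) (D : Set Cantor) : CompOn D (Cantor.cons b) := by
  refine ⟨List.cons b, (Primrec.list_cons.comp (Primrec.const b) Primrec.id).to_comp,
    fun σ τ h => ?_, fun x _ n => ⟨n, take_prefix_iff.2 fun i hi => ?_⟩⟩
  · simpa using h
  · cases i with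
    | zero => rfl
    | succ i => simpa [Cantor.cons] using getElem?_take (x := x) (show i < n by omega)

variable {D : Set Cantor} {F G : Cantor → Cantor}

theorem fst (hF : CompOn D F) : CompOn D fun x => (F x).fst :=
  (fst' Set.univ).comp hF fun _ _ => trivial

theorem snd (hF : CompOn D F) : CompOn D fun x => (F x).snd :=
  (snd' Set.univ).comp hF fun _ _ => trivial

theorem tail (hF : CompOn D F) : CompOn D fun x => (F x).tail :=
  (tail' Set.univ).comp hF fun _ _ => trivial

theorem cons (b : Bool) (hF : CompOn D F) : CompOn D fun x => Cantor.cons b (F x) :=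
  (cons' b Set.univ).comp hF fun _ _ => trivial

theorem const {c : Cantor} (hc : Computable c) (D : Set Cantor) : CompOn D fun _ => c := by
  have h : Computable c.take := by
    refine (Computable.nat_rec (f := fun n : ℕ => n) (g := fun _ => ([] : List Bool))
      (h := fun _ p => p.2 ++ [c p.1]) Computable.id (Computable.const [])
      (Computable.list_concat.comp (Computable.snd.comp Computable.snd)
        (hc.comp (Computable.fst.comp Computable.snd)))).of_eq fun n => ?_
    induction n with
    | zero => rfl
    | succ n ih =>
      simp only [take, List.range_succ, List.map_append] at ih ⊢
      rw [← ih]; rfl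
  exact ⟨fun σ => c.take σ.length, h.comp Computable.list_length,
    fun σ τ h => c.take_prefix_take h.length_le, fun x _ n => ⟨n, by simp⟩⟩

theorem zero (D : Set Cantor) : CompOn D fun _ => Cantor.zero :=
  const (Computable.const false) D

theorem pair (hF : CompOn D F) (hG : CompOn D G) : CompOn D fun x => Cantor.pair (F x) (G x) := by
  obtain ⟨v, hvc, hvm, hv⟩ := hF
  obtain ⟨w, hwc, hwm, hw⟩ := hG
  let u : List Bool × List Bool → List Bool := fun p =>
    (List.range (2 * min p.1.length p.2.length)).map fun n =>
      if n % 2 = 0 then p.1.getD (n / 2) false else p.2.getD (n / 2) false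
  have hu : Primrec u := by
    refine Primrec.list_map (Primrec.list_range.comp (Primrec.nat_mul.comp (Primrec.const 2)
      (Primrec.nat_min.comp (Primrec.list_length.comp Primrec.fst)
        (Primrec.list_length.comp Primrec.snd)))) ?_
    refine Primrec.ite (Primrec.eq.comp (Primrec.nat_mod.comp Primrec.snd (Primrec.const 2))
      (Primrec.const 0)) ?_ ?_
    · exact (Primrec.list_getD false).comp (Primrec.fst.comp Primrec.fst)
        (Primrec.nat_div.comp Primrec.snd (Primrec.const 2))
    · exact (Primrec.list_getD false).comp (Primrec.snd.comp Primrec.fst)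
        (Primrec.nat_div.comp Primrec.snd (Primrec.const 2))
  have key : ∀ (σ τ : List Bool) (n : ℕ), (u (σ, τ))[n]? =
      if n < 2 * min σ.length τ.length then
        if n % 2 = 0 then σ[n / 2]? else τ[n / 2]? else none := by
    intro σ τ n
    by_cases h : n < 2 * min σ.length τ.length
    · have h1 : n / 2 < σ.length := by omega
      have h2 : n / 2 < τ.length := by omega
      rw [if_pos h, List.getElem?_map, List.getElem?_range h]
      simp [h1, h2]
      split_ifs <;> rfl
    · simp only [if_neg h]
      simp only [u, List.getElem?_map]
      rw [List.getElem?_eq_none (by simp; omega)]; rfl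
  have hm : WordMono fun σ => u (v σ, w σ) := by
    intro σ τ h
    refine prefix_of_getElem? fun i b hb => ?_
    have h1 := hvm _ _ h
    have h2 := hwm _ _ h
    have := h1.length_le
    have := h2.length_le
    simp only [key] at hb ⊢
    split_ifs at hb with hi hpar
    · rw [if_pos (by omega), if_pos hpar]; exact getElem?_of_prefix h1 hb
    · rw [if_pos (by omega), if_neg hpar]; exact getElem?_of_prefix h2 hb
  refine ⟨_, hu.to_comp.comp (hvc.pair hwc), hm, fun x hx => Traces.of_apply hm fun i => ?_⟩
  obtain ⟨k, hk⟩ := (hv x hx).apply (i / 2)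
  obtain ⟨m, hm'⟩ := (hw x hx).apply (i / 2)
  have h1 := getElem?_of_prefix (hvm.take_prefix (le_max_left k m)) hk
  have h2 := getElem?_of_prefix (hwm.take_prefix (le_max_right k m)) hm'
  refine ⟨max k m, ?_⟩
  have h3 := (List.getElem?_eq_some_iff.1 h1).1
  have h4 := (List.getElem?_eq_some_iff.1 h2).1
  simp only [key]
  rw [if_pos (by omega), h1, h2, Cantor.pair]
  split_ifs <;> rfl

/-- Definition by cases on the first letter of a computable sequence. -/
theorem cond {B : Cantor → Cantor} (hB : CompOn D B)
    (hF : CompOn {x ∈ D | B x 0 = true} F) (hG : CompOn {x ∈ D | B x 0 = false} G) :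
    CompOn D fun x => if B x 0 then F x else G x := by
  obtain ⟨u, huc, hum, hu⟩ := hB
  obtain ⟨v, hvc, hvm, hv⟩ := hF
  obtain ⟨w, hwc, hwm, hw⟩ := hG
  -- Nothing is put out until the first letter of `B x` is known. From then on the branch is fixed,
  -- which makes `W` monotone.
  let W : List Bool → List Bool := fun σ =>
    Option.casesOn (u σ).head? [] fun b => bif b then v σ else w σ
  have hW : Computable W := by
    refine Computable.option_casesOn (Primrec.list_head?.to_comp.comp huc)
      (Computable.const []) ?_
    exact Computable.cond Computable.snd (hvc.comp Computable.fst) (hwc.comp Computable.fst)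
  have hsome : ∀ σ b, (u σ)[0]? = some b → W σ = bif b then v σ else w σ := by
    intro σ b hb
    simp only [W]
    rw [List.head?_eq_getElem?, hb]
  have hm : WordMono W := by
    intro σ τ h
    cases hb : (u σ)[0]? with
    | none =>
      have : W σ = [] := by
        simp only [W]
        rw [List.head?_eq_getElem?, hb]
      rw [this]; exact List.nil_prefix
    | some b =>
      rw [hsome σ b hb, hsome τ b (getElem?_of_prefix (hum _ _ h) hb)]
      cases b
      · exact hwm _ _ h
      · exact hvm _ _ h
  refine ⟨W, hW, hm, fun x hx => Traces.of_apply hm fun i => ?_⟩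
  obtain ⟨k, hk⟩ := (hu x hx).apply 0
  cases hb : B x 0 with
  | true =>
    obtain ⟨m, hm'⟩ := (hv x ⟨hx, hb⟩).apply i
    refine ⟨max k m, ?_⟩
    rw [hsome _ _ (getElem?_of_prefix (hum.take_prefix (le_max_left k m)) hk), hb]
    simpa [hb] using getElem?_of_prefix (hvm.take_prefix (le_max_right k m)) hm'
  | false =>
    obtain ⟨m, hm'⟩ := (hw x ⟨hx, hb⟩).apply i
    refine ⟨max k m, ?_⟩
    rw [hsome _ _ (getElem?_of_prefix (hum.take_prefix (le_max_left k m)) hk), hb]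
    simpa [hb] using getElem?_of_prefix (hwm.take_prefix (le_max_right k m)) hm'

/-- Iteration of a computable function, the number of iterations being given by a tag. -/
theorem loop {E : Set Cantor} {S T A : Cantor → Cantor} (hS : CompOn E S) (hT : CompOn D T)
    (hA : CompOn D A) (htag : ∀ x ∈ D, ∃ n q, T x = tagged n q)
    (hE : ∀ x ∈ D, ∀ i < tagCount (T x), S^[i] (A x) ∈ E) :
    CompOn D fun x => S^[tagCount (T x)] (A x) := by
  obtain ⟨s, hsc, hsm, hs⟩ := hS
  obtain ⟨t, htc, htm, ht⟩ := hT
  obtain ⟨a, hac, ham, ha⟩ := hA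
  -- Nothing is put out until the letter `1` that ends the tag has been read. After that the number
  -- of iterations no longer changes.
  let W : List Bool → List Bool := fun σ =>
    bif decide ((t σ).idxOf true < (t σ).length) then s^[(t σ).idxOf true] (a σ) else []
  have hidx : Computable fun σ => (t σ).idxOf true :=
    (Primrec.list_idxOf.comp (Primrec.const true) Primrec.id).to_comp.comp htc
  have hW : Computable W := by
    refine Computable.cond ?_ ?_ (Computable.const [])
    · exact (Primrec.nat_lt.decide.to_comp).comp
        hidx (Computable.list_length.comp htc)
    · refine (Computable.nat_rec (h := fun _ p => s p.2) hidx hac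
        (hsc.comp (Computable.snd.comp Computable.snd))).of_eq fun σ => ?_
      induction (t σ).idxOf true with
      | zero => rfl
      | succ n ih => rw [Function.iterate_succ_apply', ← ih]
  have hext : ∀ {l l' : List Bool}, l <+: l' → l.idxOf true < l.length →
      l'.idxOf true = l.idxOf true ∧ l'.idxOf true < l'.length := by
    rintro l _ ⟨r, rfl⟩ hl
    have := List.idxOf_append_of_mem (l₂ := r) (List.idxOf_lt_length_iff.1 hl)
    rw [this]
    exact ⟨rfl, by simp; omega⟩
  have hm : WordMono W := by
    intro σ τ h
    by_cases hlt : (t σ).idxOf true < (t σ).length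
    · obtain ⟨h1, h2⟩ := hext (htm _ _ h) hlt
      simp only [W, hlt, h1, decide_true, cond_true, h1 ▸ h2]
      exact hsm.iterate _ _ _ (ham _ _ h)
    · simp only [W, hlt, decide_false, cond_false]
      exact List.nil_prefix
  refine ⟨W, hW, hm, fun x hx => Traces.of_apply hm fun i => ?_⟩
  obtain ⟨n, q, hq⟩ := htag x hx
  have hEx := hE x hx
  have htx := ht x hx
  simp only [hq, tagCount_tagged] at hEx htx ⊢
  have hiter : ∀ m ≤ n, Traces (s^[m] ∘ a) x (S^[m] (A x)) := by
    intro m hmn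
    induction m with
    | zero => exact ha x hx
    | succ m ih =>
      rw [Function.iterate_succ', Function.iterate_succ', Function.comp_assoc]
      exact (ih (by omega)).comp (hs _ (hEx m (by omega))) hsm
  obtain ⟨k, hk⟩ := htx (n + 1)
  obtain ⟨m, hm'⟩ := (hiter n le_rfl).apply i
  have hk' := hk.trans (htm.take_prefix (x := x) (le_max_left k m))
  have hidx' : ((tagged n q).take (n + 1)).idxOf true = n := by
    have hn : (tagged n q).take (n + 1) = List.replicate n false ++ [true] := by
      rw [take, List.range_succ, List.map_append, List.map_singleton, tagged_apply_self]
      congr 1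
      rw [List.eq_replicate_iff]
      refine ⟨by simp, fun b hb => ?_⟩
      obtain ⟨j, hj, rfl⟩ := List.mem_map.1 hb
      exact tagged_apply_lt q (List.mem_range.1 hj)
    rw [hn, List.idxOf_append_of_notMem (by simp)]
    simp
  obtain ⟨h1, h2⟩ := hext hk' (by rw [hidx']; simp)
  rw [hidx'] at h1
  refine ⟨max k m, ?_⟩
  simp only [W, h1, decide_true, cond_true, h1 ▸ h2]
  exact getElem?_of_prefix ((hsm.iterate n |>.comp ham).take_prefix (le_max_right k m)) hm'

theorem untag (hF : CompOn D F) (htag : ∀ x ∈ D, ∃ n q, F x = tagged n q) :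
    CompOn D fun x => (F x).untag :=
  (loop (tail' Set.univ) hF hF htag fun _ _ _ _ => trivial).tail.congr fun x _ => by
    rw [Cantor.untag, Function.iterate_succ_apply']

theorem tagged (hF : CompOn D F) (htag : ∀ x ∈ D, ∃ n q, F x = tagged n q) (hG : CompOn D G) :
    CompOn D fun x => Cantor.tagged (tagCount (F x)) (G x) :=
  loop (cons' false Set.univ) hF (hG.cons true) htag fun _ _ _ _ => trivial

end CompOn

theorem CompOn.comp₂ {D E : Set Cantor} {K : Cantor → Cantor → Cantor} {A B : Cantor → Cantor}
    (hK : CompOn E fun z => K z.fst z.snd) (hA : CompOn D A) (hB : CompOn D B)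
    (h : ∀ x ∈ D, Cantor.pair (A x) (B x) ∈ E) : CompOn D fun x => K (A x) (B x) :=
  (hK.comp (hA.pair hB) h).congr fun x _ => by simp

theorem CompOn.computableFun {D : Set Cantor} {F : Cantor → Cantor} (h : CompOn D F) :
    ComputableFun fun x => ⟨x ∈ D, fun _ => F x⟩ := by
  obtain ⟨w, hc, hm, hw⟩ := h
  refine ⟨w, hc, hm, ?_⟩
  rintro x y ⟨hx, rfl⟩ n
  exact hw x hx n

-- Total functions with an explicit set of good arguments are easier to compose than partial ones.
-- The value outside the domain is arbitrary and never consulted.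
open Classical in
theorem ComputableFun.exists_compOn {F : Cantor →. Cantor} (h : ComputableFun F) :
    ∃ G : Cantor → Cantor, CompOn {x | (F x).Dom} G ∧ ∀ x y, y ∈ F x → G x = y := by
  obtain ⟨w, hc, hm, hw⟩ := h
  refine ⟨fun x => if hx : (F x).Dom then (F x).get hx else Cantor.zero, ⟨w, hc, hm, ?_⟩, ?_⟩
  · intro x hx
    have hx' : (F x).Dom := hx
    simp only [hx', dite_true]
    exact hw x _ (Part.get_mem hx')
  · rintro x y ⟨hx, rfl⟩
    simp [hx]

/-! ### Instances and solutions of the operations -/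

namespace MultiFun

theorem mem_dom_prod {f g : MultiFun} {x : Cantor} :
    x ∈ (prod f g).dom ↔ x.fst ∈ f.dom ∧ x.snd ∈ g.dom := by
  constructor
  · rintro ⟨y, p, hp, q, hq, rfl⟩; exact ⟨⟨p, hp⟩, ⟨q, hq⟩⟩
  · rintro ⟨⟨p, hp⟩, ⟨q, hq⟩⟩; exact ⟨_, p, hp, q, hq, rfl⟩

theorem mem_prod {f g : MultiFun} {x y : Cantor} :
    y ∈ prod f g x ↔ y.fst ∈ f x.fst ∧ y.snd ∈ g x.snd := by
  constructor
  · rintro ⟨p, hp, q, hq, rfl⟩; simpa using ⟨hp, hq⟩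
  · rintro ⟨hp, hq⟩; exact ⟨_, hp, _, hq, (pair_fst_snd y).symm⟩

theorem mem_dom_meet {f g : MultiFun} {x : Cantor} :
    x ∈ (meet f g).dom ↔ x.fst ∈ f.dom ∧ x.snd ∈ g.dom := by
  constructor
  · rintro ⟨y, h₁, h₂, -⟩; exact ⟨h₁, h₂⟩
  · rintro ⟨h₁, h₂⟩
    obtain ⟨p, hp⟩ := h₁
    exact ⟨_, ⟨p, hp⟩, h₂, Or.inl ⟨p, hp, rfl⟩⟩

theorem mem_meet {f g : MultiFun} {x y : Cantor} :
    y ∈ meet f g x ↔ (x.fst ∈ f.dom ∧ x.snd ∈ g.dom) ∧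
      if y 0 then y.tail ∈ g x.snd else y.tail ∈ f x.fst := by
  constructor
  · rintro ⟨h₁, h₂, ⟨p, hp, rfl⟩ | ⟨p, hp, rfl⟩⟩ <;> exact ⟨⟨h₁, h₂⟩, by simpa using hp⟩
  · rintro ⟨⟨h₁, h₂⟩, h⟩
    refine ⟨h₁, h₂, ?_⟩
    cases hy : y 0
    · exact Or.inl ⟨y.tail, by simpa [hy] using h, by rw [← hy, cons_tail]⟩
    · exact Or.inr ⟨y.tail, by simpa [hy] using h, by rw [← hy, cons_tail]⟩

theorem mem_join_cons {f g : MultiFun} {b : Bool} {x y : Cantor} :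
    y ∈ join f g (cons b x) ↔ y 0 = b ∧ if b then y.tail ∈ g x else y.tail ∈ f x := by
  constructor
  · rintro (⟨q, p, hp, hq, rfl⟩ | ⟨q, p, hp, hq, rfl⟩) <;>
    · obtain ⟨rfl, rfl⟩ := cons_injective hq
      simpa using hp
  · rintro ⟨rfl, h⟩
    cases hy : y 0
    · exact Or.inl ⟨x, y.tail, by simpa [hy] using h, rfl, by rw [← hy, cons_tail]⟩
    · exact Or.inr ⟨x, y.tail, by simpa [hy] using h, rfl, by rw [← hy, cons_tail]⟩

theorem mem_join {f g : MultiFun} {x y : Cantor} :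
    y ∈ join f g x ↔ y 0 = x 0 ∧ if x 0 then y.tail ∈ g x.tail else y.tail ∈ f x.tail := by
  conv_lhs => rw [← cons_tail x]
  exact mem_join_cons

theorem mem_dom_join {f g : MultiFun} {x : Cantor} :
    x ∈ (join f g).dom ↔ if x 0 then x.tail ∈ g.dom else x.tail ∈ f.dom := by
  constructor
  · rintro ⟨y, hy⟩
    obtain ⟨-, h⟩ := mem_join.1 hy
    split_ifs at h ⊢
    exacts [⟨_, h⟩, ⟨_, h⟩]
  · intro h
    cases hx : x 0
    · simp only [hx] at h
      obtain ⟨y, hy⟩ := h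
      exact ⟨cons false y, mem_join.2 (by simpa [hx] using hy)⟩
    · simp only [hx] at h
      obtain ⟨y, hy⟩ := h
      exact ⟨cons true y, mem_join.2 (by simpa [hx] using hy)⟩

end MultiFun

open MultiFun

/-! ### Uniform reducibility of families -/

/-- Weihrauch reducibility of two families of multivalued functions, with the same two computable
functions for all members. -/
def URed {ι : Type} (F G : ι → MultiFun) : Prop :=
  ∃ (H : Cantor → Cantor) (K : Cantor → Cantor → Cantor),
    CompOn {x | ∃ i, x ∈ (F i).dom} H ∧
    CompOn {z | ∃ i, z.fst ∈ (F i).dom ∧ z.snd ∈ G i (H z.fst)} (fun z => K z.fst z.snd) ∧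
    ∀ i, ∀ x ∈ (F i).dom, H x ∈ (G i).dom ∧ ∀ y ∈ G i (H x), K x y ∈ F i x

theorem uRed_of_reducible {f g : MultiFun} (h : Reducible f g) :
    URed (fun _ : Unit => f) fun _ => g := by
  obtain ⟨H, K, hH, hK, h⟩ := h
  obtain ⟨H', hH', hHeq⟩ := hH.exists_compOn
  obtain ⟨K', hK', hKeq⟩ := hK.exists_compOn
  refine ⟨H', fun x y => K' (Cantor.pair x y), hH'.mono ?_,
    (hK'.mono ?_).congr fun z _ => by simp, ?_⟩
  · rintro x ⟨_, hx⟩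
    obtain ⟨y, hy, -⟩ := h x hx
    exact hy.1
  · rintro z ⟨_, hx, hz⟩
    obtain ⟨y, hy, -, hyz⟩ := h _ hx
    rw [hHeq _ _ hy] at hz
    obtain ⟨u, hu, -⟩ := hyz _ hz
    rw [pair_fst_snd] at hu
    exact hu.1
  · intro _ x hx
    obtain ⟨y, hy, hyd, hyz⟩ := h _ hx
    rw [hHeq _ _ hy]
    refine ⟨hyd, fun z hz => ?_⟩
    obtain ⟨u, hu, hux⟩ := hyz _ hz
    simpa only [hKeq _ _ hu] using hux

theorem URed.reducible {ι : Type} {F G : ι → MultiFun} (h : URed F G) (i : ι) :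
    Reducible (F i) (G i) := by
  obtain ⟨H, K, hH, hK, h⟩ := h
  refine ⟨_, _, hH.computableFun, hK.computableFun, fun x hx => ?_⟩
  obtain ⟨hd, hy⟩ := h i x hx
  refine ⟨H x, ⟨⟨i, hx⟩, rfl⟩, hd, fun y hyG => ?_⟩
  exact ⟨K x y, ⟨⟨i, by simpa using ⟨hx, hyG⟩⟩, by simp⟩, hy y hyG⟩

theorem reducible_iff {f g : MultiFun} :
    Reducible f g ↔ URed (fun _ : Unit => f) fun _ => g :=
  ⟨uRed_of_reducible, fun h => h.reducible ()⟩

namespace URed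

variable {ι κ : Type} {F F' G G' L : ι → MultiFun}

theorem refl (F : ι → MultiFun) : URed F F :=
  ⟨fun x => x, fun _ y => y, CompOn.id _, (CompOn.id _).snd,
    fun _ _ hx => ⟨hx, fun _ hy => hy⟩⟩

theorem reindex (h : URed F G) (φ : κ → ι) : URed (fun k => F (φ k)) fun k => G (φ k) := by
  obtain ⟨H, K, hH, hK, h⟩ := h
  exact ⟨H, K, hH.mono fun x ⟨k, hk⟩ => ⟨_, hk⟩, hK.mono fun x ⟨k, hk⟩ => ⟨_, hk⟩,
    fun k => h (φ k)⟩

theorem trans (h₁ : URed F G) (h₂ : URed G L) : URed F L := by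
  obtain ⟨H₁, K₁, hH₁, hK₁, h₁⟩ := h₁
  obtain ⟨H₂, K₂, hH₂, hK₂, h₂⟩ := h₂
  refine ⟨fun x => H₂ (H₁ x), fun x y => K₁ x (K₂ (H₁ x) y), ?_, ?_, ?_⟩
  · exact hH₂.comp hH₁ fun x ⟨i, hx⟩ => ⟨i, (h₁ i x hx).1⟩
  · refine hK₁.comp₂ (CompOn.id _).fst (hK₂.comp₂ (hH₁.comp (CompOn.id _).fst ?_)
      (CompOn.id _).snd ?_) ?_
    · exact fun z ⟨i, hz, _⟩ => ⟨i, hz⟩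
    · exact fun z ⟨i, hz, hy⟩ => ⟨i, by simpa using ⟨(h₁ i _ hz).1, hy⟩⟩
    · exact fun z ⟨i, hz, hy⟩ => ⟨i, by simpa using ⟨hz, (h₂ i _ (h₁ i _ hz).1).2 _ hy⟩⟩
  · intro i x hx
    obtain ⟨hd, hy⟩ := h₁ i x hx
    obtain ⟨hd', hy'⟩ := h₂ i _ hd
    exact ⟨hd', fun y hyL => hy _ (hy' y hyL)⟩

theorem prod_mono (h₁ : URed F F') (h₂ : URed G G') :
    URed (fun i => MultiFun.prod (F i) (G i)) fun i => MultiFun.prod (F' i) (G' i) := by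
  obtain ⟨H₁, K₁, hH₁, hK₁, h₁⟩ := h₁
  obtain ⟨H₂, K₂, hH₂, hK₂, h₂⟩ := h₂
  refine ⟨fun x => Cantor.pair (H₁ x.fst) (H₂ x.snd),
    fun x y => Cantor.pair (K₁ x.fst y.fst) (K₂ x.snd y.snd), ?_, ?_, ?_⟩
  · refine (hH₁.comp (CompOn.id _).fst ?_).pair (hH₂.comp (CompOn.id _).snd ?_)
    · exact fun x ⟨i, hx⟩ => ⟨i, (mem_dom_prod.1 hx).1⟩
    · exact fun x ⟨i, hx⟩ => ⟨i, (mem_dom_prod.1 hx).2⟩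
  · simp only [mem_dom_prod, mem_prod, fst_pair, snd_pair]
    refine (hK₁.comp₂ (CompOn.id _).fst.fst (CompOn.id _).snd.fst ?_).pair
      (hK₂.comp₂ (CompOn.id _).fst.snd (CompOn.id _).snd.snd ?_)
    · rintro z ⟨i, hz, hy⟩
      exact ⟨i, by simpa using ⟨hz.1, hy.1⟩⟩
    · rintro z ⟨i, hz, hy⟩
      exact ⟨i, by simpa using ⟨hz.2, hy.2⟩⟩
  · intro i x hx
    simp only [mem_dom_prod, mem_prod, fst_pair, snd_pair] at hx ⊢
    obtain ⟨hd, hy⟩ := h₁ i _ hx.1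
    obtain ⟨hd', hy'⟩ := h₂ i _ hx.2
    exact ⟨⟨hd, hd'⟩, fun y h => ⟨hy _ h.1, hy' _ h.2⟩⟩

theorem meet_mono (h₁ : URed F F') (h₂ : URed G G') :
    URed (fun i => meet (F i) (G i)) fun i => meet (F' i) (G' i) := by
  obtain ⟨H₁, K₁, hH₁, hK₁, h₁⟩ := h₁
  obtain ⟨H₂, K₂, hH₂, hK₂, h₂⟩ := h₂
  refine ⟨fun x => Cantor.pair (H₁ x.fst) (H₂ x.snd), fun x y =>
    if y 0 then cons true (K₂ x.snd y.tail) else cons false (K₁ x.fst y.tail), ?_, ?_, ?_⟩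
  · refine (hH₁.comp (CompOn.id _).fst ?_).pair (hH₂.comp (CompOn.id _).snd ?_)
    · exact fun x ⟨i, hx⟩ => ⟨i, (mem_dom_meet.1 hx).1⟩
    · exact fun x ⟨i, hx⟩ => ⟨i, (mem_dom_meet.1 hx).2⟩
  · simp only [mem_dom_meet, mem_meet, fst_pair, snd_pair]
    refine (CompOn.id _).snd.cond ((hK₂.comp₂ (CompOn.id _).fst.snd (CompOn.id _).snd.tail ?_).cons _)
      ((hK₁.comp₂ (CompOn.id _).fst.fst (CompOn.id _).snd.tail ?_).cons _)
    · rintro z ⟨⟨i, hz, -, hy⟩, hb⟩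
      exact ⟨i, by simpa [hb] using ⟨hz.2, by simpa [hb] using hy⟩⟩
    · rintro z ⟨⟨i, hz, -, hy⟩, hb⟩
      exact ⟨i, by simpa [hb] using ⟨hz.1, by simpa [hb] using hy⟩⟩
  · intro i x hx
    simp only [mem_dom_meet, mem_meet, fst_pair, snd_pair] at hx ⊢
    obtain ⟨hd, hy⟩ := h₁ i _ hx.1
    obtain ⟨hd', hy'⟩ := h₂ i _ hx.2
    refine ⟨⟨hd, hd'⟩, fun y h => ⟨hx, ?_⟩⟩
    have h := h.2
    split_ifs at h with hb
    · simpa [hb] using hy' _ h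
    · simpa [hb] using hy _ h

theorem le_join_left (F G : ι → MultiFun) : URed F fun i => join (F i) (G i) :=
  ⟨cons false, fun _ y => y.tail, CompOn.cons' _ _, (CompOn.id _).snd.tail, fun i x hx =>
    ⟨mem_dom_join.2 (by simpa using hx), fun y hy => by simpa using (mem_join_cons.1 hy).2⟩⟩

theorem le_join_right (F G : ι → MultiFun) : URed G fun i => join (F i) (G i) :=
  ⟨cons true, fun _ y => y.tail, CompOn.cons' _ _, (CompOn.id _).snd.tail, fun i x hx =>
    ⟨mem_dom_join.2 (by simpa using hx), fun y hy => by simpa using (mem_join_cons.1 hy).2⟩⟩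

theorem join_le (h₁ : URed F L) (h₂ : URed G L) : URed (fun i => join (F i) (G i)) L := by
  obtain ⟨H₁, K₁, hH₁, hK₁, h₁⟩ := h₁
  obtain ⟨H₂, K₂, hH₂, hK₂, h₂⟩ := h₂
  refine ⟨fun x => if x 0 then H₂ x.tail else H₁ x.tail, fun x y =>
    if x 0 then cons true (K₂ x.tail y) else cons false (K₁ x.tail y), ?_, ?_, ?_⟩
  · refine (CompOn.id _).cond (hH₂.comp (CompOn.id _).tail ?_) (hH₁.comp (CompOn.id _).tail ?_)
    · rintro x ⟨⟨i, hx⟩, hb⟩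
      exact ⟨i, by simpa [mem_dom_join, hb] using hx⟩
    · rintro x ⟨⟨i, hx⟩, hb⟩
      exact ⟨i, by simpa [mem_dom_join, hb] using hx⟩
  · refine (CompOn.id _).fst.cond
      ((hK₂.comp₂ (CompOn.id _).fst.tail (CompOn.id _).snd ?_).cons _)
      ((hK₁.comp₂ (CompOn.id _).fst.tail (CompOn.id _).snd ?_).cons _)
    · rintro x ⟨⟨i, hx, hy⟩, hb⟩
      exact ⟨i, by simpa [mem_dom_join, hb] using hx, by simpa [hb] using hy⟩
    · rintro x ⟨⟨i, hx, hy⟩, hb⟩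
      exact ⟨i, by simpa [mem_dom_join, hb] using hx, by simpa [hb] using hy⟩
  · intro i x hx
    rw [mem_dom_join] at hx
    simp only [mem_join]
    cases hb : x 0 <;> simp only [hb, if_true, if_false, Bool.false_eq_true] at hx ⊢
    · exact ⟨(h₁ i _ hx).1, fun y hy => by simpa using (h₁ i _ hx).2 y hy⟩
    · exact ⟨(h₂ i _ hx).1, fun y hy => by simpa using (h₂ i _ hx).2 y hy⟩

theorem join_mono (h₁ : URed F F') (h₂ : URed G G') :
    URed (fun i => join (F i) (G i)) fun i => join (F' i) (G' i) :=
  join_le (h₁.trans (le_join_left _ _)) (h₂.trans (le_join_right _ _))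

/-- The letter that selects `G` or `L` moves from the second instance to the front. On the way back
it is restored only if the solution is one of `G` or `L`; a solution of `F` just loses it. -/
theorem meet_join_le (F G L : ι → MultiFun) :
    URed (fun i => meet (F i) (join (G i) (L i)))
      fun i => join (meet (F i) (G i)) (meet (F i) (L i)) := by
  refine ⟨fun x => cons (x.snd 0) (Cantor.pair x.fst x.snd.tail), fun _ y =>
    if y.tail 0 then cons true (cons (y 0) y.tail.tail) else cons false y.tail.tail, ?_, ?_, ?_⟩
  · refine CompOn.congr (F := fun x => if x.snd 0 then cons true (Cantor.pair x.fst x.snd.tail)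
      else cons false (Cantor.pair x.fst x.snd.tail)) ?_ fun x _ => by cases x.snd 0 <;> rfl
    exact (CompOn.id _).snd.cond (((CompOn.id _).fst.pair (CompOn.id _).snd.tail).cons _)
      (((CompOn.id _).fst.pair (CompOn.id _).snd.tail).cons _)
  · refine (CompOn.id _).snd.tail.cond ?_ ((CompOn.id _).snd.tail.tail.cons _)
    refine CompOn.congr (F := fun z => if z.snd 0 then cons true (cons true z.snd.tail.tail)
      else cons true (cons false z.snd.tail.tail)) ?_ fun z _ => by cases z.snd 0 <;> rfl
    exact (CompOn.id _).snd.cond (((CompOn.id _).snd.tail.tail.cons _).cons _)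
      (((CompOn.id _).snd.tail.tail.cons _).cons _)
  · intro i x hx
    rw [mem_dom_meet, mem_dom_join] at hx
    refine ⟨mem_dom_join.2 ?_, fun y hy => ?_⟩
    · cases hb : x.snd 0 <;> simpa [mem_dom_meet, hb] using hx
    · rw [mem_join_cons] at hy
      rw [mem_meet, mem_dom_join]
      cases hb : x.snd 0 <;> cases hc : y.tail 0 <;> simp_all [mem_meet, mem_join]

theorem prod_join_le (F G L : ι → MultiFun) :
    URed (fun i => MultiFun.prod (F i) (join (G i) (L i)))
      fun i => join (MultiFun.prod (F i) (G i)) (MultiFun.prod (F i) (L i)) := by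
  refine ⟨fun x => cons (x.snd 0) (Cantor.pair x.fst x.snd.tail), fun _ y =>
    Cantor.pair y.tail.fst (cons (y 0) y.tail.snd), ?_, ?_, ?_⟩
  · refine CompOn.congr (F := fun x => if x.snd 0 then cons true (Cantor.pair x.fst x.snd.tail)
      else cons false (Cantor.pair x.fst x.snd.tail)) ?_ fun x _ => by cases x.snd 0 <;> rfl
    exact (CompOn.id _).snd.cond (((CompOn.id _).fst.pair (CompOn.id _).snd.tail).cons _)
      (((CompOn.id _).fst.pair (CompOn.id _).snd.tail).cons _)
  · refine (CompOn.id _).snd.tail.fst.pair ?_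
    refine CompOn.congr (F := fun z => if z.snd 0 then cons true z.snd.tail.snd
      else cons false z.snd.tail.snd) ?_ fun z _ => by cases z.snd 0 <;> rfl
    exact (CompOn.id _).snd.cond ((CompOn.id _).snd.tail.snd.cons _)
      ((CompOn.id _).snd.tail.snd.cons _)
  · intro i x hx
    rw [mem_dom_prod, mem_dom_join] at hx
    refine ⟨mem_dom_join.2 ?_, fun y hy => ?_⟩
    · cases hb : x.snd 0 <;> simpa [mem_dom_prod, hb] using hx
    · rw [mem_join_cons] at hy
      cases hb : x.snd 0 <;> simp_all [mem_prod, mem_join]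

/-- Pointed functions are exactly those above `1`; here the instance serves a whole family. -/
theorem one_le {c : Cantor} (hc : Computable c) (h : ∀ i, c ∈ (F i).dom) :
    URed (fun _ => MultiFun.one) F :=
  ⟨fun _ => c, fun x _ => x, CompOn.const hc _, (CompOn.id _).fst, fun i _ _ =>
    ⟨h i, fun _ _ => rfl⟩⟩

end URed

namespace BaseTerm

/-! ### Occurrences of variables in terms -/

/-- The occurrences of variables in a term. -/
def Pos : BaseTerm → Type
  | var _ => Unit
  | one => Empty
  | meet t u => Pos t ⊕ Pos u
  | prod t u => Pos t ⊕ Pos u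

/-- The variable at an occurrence. -/
def label : (t : BaseTerm) → Pos t → ℕ
  | var n, _ => n
  | one, p => p.elim
  | meet t u, p => Sum.elim (label t) (label u) p
  | prod t u, p => Sum.elim (label t) (label u) p

/-- Answers to the questions at the occurrences in `S` suffice to solve the term. -/
def Sol : (t : BaseTerm) → (Pos t → Prop) → Prop
  | var _, S => S ()
  | one, _ => True
  | meet t u, S => Sol t (fun p => S (Sum.inl p)) ∨ Sol u (fun p => S (Sum.inr p))
  | prod t u, S => Sol t (fun p => S (Sum.inl p)) ∧ Sol u (fun p => S (Sum.inr p))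

/-- The question at an occurrence, in an instance of the term. -/
def query : (t : BaseTerm) → Cantor → Pos t → Cantor
  | var _, x, _ => x
  | one, _, p => p.elim
  | meet t u, x, p => Sum.elim (query t x.fst) (query u x.snd) p
  | prod t u, x, p => Sum.elim (query t x.fst) (query u x.snd) p

/-- The instance of a term with given questions at the occurrences. -/
def build : (t : BaseTerm) → (Pos t → Cantor) → Cantor
  | var _, e => e ()
  | one, _ => Cantor.zero
  | meet t u, e => Cantor.pair (build t fun p => e (Sum.inl p)) (build u fun p => e (Sum.inr p))
  | prod t u, e => Cantor.pair (build t fun p => e (Sum.inl p)) (build u fun p => e (Sum.inr p))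

/-- The answer at an occurrence that is contained in a solution of the term. -/
def ans : (t : BaseTerm) → Cantor → Pos t → Cantor
  | var _, y, _ => y
  | one, _, p => p.elim
  | meet t u, y, p => Sum.elim (ans t y.tail) (ans u y.tail) p
  | prod t u, y, p => Sum.elim (ans t y.fst) (ans u y.snd) p

/-- The occurrences that are answered in a solution of the term. -/
def sel : (t : BaseTerm) → Cantor → Pos t → Prop
  | var _, _ => fun _ => True
  | one, _ => fun p => p.elim
  | meet t u, y => if y 0 then Sum.elim (fun _ => False) (sel u y.tail)
      else Sum.elim (sel t y.tail) (fun _ => False)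
  | prod t u, y => Sum.elim (sel t y.fst) (sel u y.snd)

open Classical in
/-- A solution of the instance `x` of a term, from answers to the questions in `S`. -/
noncomputable def assemble : (t : BaseTerm) → (Pos t → Prop) → Cantor → (Pos t → Cantor) → Cantor
  | var _, _, _, e => e ()
  | one, _, x, _ => x
  | meet t u, S, x, e =>
    if Sol t (fun p => S (Sum.inl p)) then
      cons false (assemble t (fun p => S (Sum.inl p)) x.fst fun p => e (Sum.inl p))
    else cons true (assemble u (fun p => S (Sum.inr p)) x.snd fun p => e (Sum.inr p))
  | prod t u, S, x, e =>
    Cantor.pair (assemble t (fun p => S (Sum.inl p)) x.fst fun p => e (Sum.inl p))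
      (assemble u (fun p => S (Sum.inr p)) x.snd fun p => e (Sum.inr p))

theorem finite_pos (t : BaseTerm) : Finite (Pos t) := by
  induction t with
  | var n => exact inferInstanceAs (Finite Unit)
  | one => exact inferInstanceAs (Finite Empty)
  | meet t u iht ihu | prod t u iht ihu => exact inferInstanceAs (Finite (Pos t ⊕ Pos u))

theorem Sol.mono {t : BaseTerm} {S T : Pos t → Prop} (h : Sol t S) (hST : ∀ p, S p → T p) :
    Sol t T := by
  induction t with
  | var n => exact hST () h
  | one => trivial
  | meet t u iht ihu =>
    exact h.imp (fun h => iht h fun p => hST _) (fun h => ihu h fun p => hST _)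
  | prod t u iht ihu => exact ⟨iht h.1 fun p => hST _, ihu h.2 fun p => hST _⟩

theorem query_build (t : BaseTerm) (e : Pos t → Cantor) (p : Pos t) :
    query t (build t e) p = e p := by
  induction t with
  | var n => rfl
  | one => exact p.elim
  | meet t u iht ihu | prod t u iht ihu =>
    rcases p with p | p
    · simpa [query, build] using iht _ p
    · simpa [query, build] using ihu _ p

theorem mem_dom_interp {t : BaseTerm} {ρ : ℕ → MultiFun} {x : Cantor} :
    x ∈ (t.interp ρ).dom ↔ ∀ p, query t x p ∈ (ρ (label t p)).dom := by
  induction t generalizing x with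
  | var n => exact ⟨fun h _ => h, fun h => h ()⟩
  | one => exact ⟨fun _ p => p.elim, fun _ => ⟨x, rfl⟩⟩
  | meet t u iht ihu =>
    simp only [interp, mem_dom_meet, iht, ihu]
    exact ⟨fun h p => p.rec h.1 h.2, fun h => ⟨fun p => h (Sum.inl p), fun p => h (Sum.inr p)⟩⟩
  | prod t u iht ihu =>
    simp only [interp, mem_dom_prod, iht, ihu]
    exact ⟨fun h p => p.rec h.1 h.2, fun h => ⟨fun p => h (Sum.inl p), fun p => h (Sum.inr p)⟩⟩

theorem assemble_mem {t : BaseTerm} {ρ : ℕ → MultiFun} {x : Cantor} {S : Pos t → Prop}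
    {e : Pos t → Cantor} (hx : x ∈ (t.interp ρ).dom) (hS : Sol t S)
    (he : ∀ p, S p → e p ∈ ρ (label t p) (query t x p)) : assemble t S x e ∈ t.interp ρ x := by
  induction t generalizing x with
  | var n => exact he () hS
  | one => rfl
  | meet t u iht ihu =>
    have hx' := mem_dom_meet.1 hx
    simp only [assemble]
    split_ifs with h
    · exact mem_meet.2 ⟨hx', by simpa using iht hx'.1 h fun p hp => he _ hp⟩
    · exact mem_meet.2
        ⟨hx', by simpa using ihu hx'.2 (hS.resolve_left h) fun p hp => he _ hp⟩
  | prod t u iht ihu =>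
    have hx' := mem_dom_prod.1 hx
    refine mem_prod.2 ?_
    simp only [assemble, fst_pair, snd_pair]
    exact ⟨iht hx'.1 hS.1 fun p hp => he _ hp, ihu hx'.2 hS.2 fun p hp => he _ hp⟩

theorem sel_meet_of_true (t u : BaseTerm) {y : Cantor} (h : y 0 = true) :
    sel (meet t u) y = Sum.elim (fun _ => False) (sel u y.tail) := if_pos h

theorem sel_meet_of_false (t u : BaseTerm) {y : Cantor} (h : y 0 = false) :
    sel (meet t u) y = Sum.elim (sel t y.tail) (fun _ => False) :=
  if_neg (by simp [h])

theorem sol_sel {t : BaseTerm} {y : Cantor} : Sol t (sel t y) := by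
  induction t generalizing y with
  | var n => trivial
  | one => trivial
  | meet t u iht ihu =>
    cases hb : y 0
    · rw [sel_meet_of_false t u hb]; exact Or.inl iht
    · rw [sel_meet_of_true t u hb]; exact Or.inr ihu
  | prod t u iht ihu => exact ⟨iht, ihu⟩

theorem ans_mem {t : BaseTerm} {ρ : ℕ → MultiFun} {x y : Cantor} (hy : y ∈ t.interp ρ x)
    {p : Pos t} (hp : sel t y p) : ans t y p ∈ ρ (label t p) (query t x p) := by
  induction t generalizing x y with
  | var n => exact hy
  | one => exact p.elim
  | meet t u iht ihu =>
    obtain ⟨-, h⟩ := mem_meet.1 hy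
    cases hb : y 0
    · rw [sel_meet_of_false t u hb] at hp
      rcases p with p | p
      · exact iht (by simpa [hb] using h) hp
      · exact hp.elim
    · rw [sel_meet_of_true t u hb] at hp
      rcases p with p | p
      · exact hp.elim
      · exact ihu (by simpa [hb] using h) hp
  | prod t u iht ihu =>
    obtain ⟨h₁, h₂⟩ := mem_prod.1 hy
    rcases p with p | p
    · exact iht h₁ hp
    · exact ihu h₂ hp

theorem compOn_query {D : Set Cantor} {X : Cantor → Cantor} (hX : CompOn D X) (t : BaseTerm)
    (p : Pos t) : CompOn D fun z => query t (X z) p := by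
  induction t generalizing X with
  | var n => exact hX
  | one => exact p.elim
  | meet t u iht ihu | prod t u iht ihu =>
    rcases p with p | p
    · exact iht hX.fst p
    · exact ihu hX.snd p

theorem compOn_build {D : Set Cantor} (t : BaseTerm) {e : Cantor → Pos t → Cantor}
    (he : ∀ p, CompOn D fun z => e z p) : CompOn D fun z => build t (e z) := by
  induction t with
  | var n => exact he ()
  | one => exact CompOn.zero D
  | meet t u iht ihu | prod t u iht ihu =>
    exact (iht fun p => he (Sum.inl p)).pair (ihu fun p => he (Sum.inr p))

theorem compOn_ans {D : Set Cantor} {Y : Cantor → Cantor} (hY : CompOn D Y) (t : BaseTerm)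
    (p : Pos t) : CompOn D fun z => ans t (Y z) p := by
  induction t generalizing Y with
  | var n => exact hY
  | one => exact p.elim
  | meet t u iht ihu =>
    rcases p with p | p
    · exact iht hY.tail p
    · exact ihu hY.tail p
  | prod t u iht ihu =>
    rcases p with p | p
    · exact iht hY.fst p
    · exact ihu hY.snd p

theorem compOn_assemble {D : Set Cantor} {X : Cantor → Cantor} (hX : CompOn D X) (t : BaseTerm)
    {S : Pos t → Prop} (hS : Sol t S) {e : Cantor → Pos t → Cantor}
    (he : ∀ p, S p → CompOn D fun z => e z p) :
    CompOn D fun z => assemble t S (X z) (e z) := by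
  induction t generalizing X with
  | var n => exact he () hS
  | one => exact hX
  | meet t u iht ihu =>
    simp only [assemble]
    split_ifs with h
    · exact (iht hX.fst h fun p hp => he _ hp).cons _
    · exact (ihu hX.snd (hS.resolve_left h) fun p hp => he _ hp).cons _
  | prod t u iht ihu =>
    exact (iht hX.fst hS.1 fun p hp => he _ hp).pair (ihu hX.snd hS.2 fun p hp => he _ hp)

/-- A computation may depend on which occurrences a solution answers. -/
theorem compOn_sel {D : Set Cantor} {Y : Cantor → Cantor} (hY : CompOn D Y) (t : BaseTerm)
    {G : (Pos t → Prop) → Cantor → Cantor}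
    (hG : ∀ S, CompOn {z ∈ D | sel t (Y z) = S} (G S)) :
    CompOn D fun z => G (sel t (Y z)) z := by
  induction t generalizing D Y with
  | var n => exact (hG fun _ => True).mono fun z hz => ⟨hz, rfl⟩
  | one =>
    exact ((hG fun p => p.elim).congr fun z hz => by rw [hz.2]).mono fun z hz => ⟨hz, rfl⟩
  | meet t u iht ihu =>
    refine CompOn.congr (F := fun z => if Y z 0
      then G (Sum.elim (fun _ => False) (sel u (Y z).tail)) z
      else G (Sum.elim (sel t (Y z).tail) (fun _ => False)) z) (hY.cond ?_ ?_) fun z _ => ?_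
    · refine ihu (G := fun S => G (Sum.elim (fun _ => False) S))
        (hY.tail.mono fun z hz => hz.1) fun S => (hG _).mono ?_
      rintro z ⟨⟨hz, hb⟩, rfl⟩
      exact ⟨hz, sel_meet_of_true t u hb⟩
    · refine iht (G := fun S => G (Sum.elim S (fun _ => False)))
        (hY.tail.mono fun z hz => hz.1) fun S => (hG _).mono ?_
      rintro z ⟨⟨hz, hb⟩, rfl⟩
      exact ⟨hz, sel_meet_of_false t u hb⟩
    · cases hb : Y z 0
      · rw [sel_meet_of_false t u hb]; rfl
      · rw [sel_meet_of_true t u hb]; rfl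
  | prod t u iht ihu =>
    refine iht (G := fun S z => G (Sum.elim S (sel u (Y z).snd)) z) hY.fst fun S => ?_
    refine ihu (G := fun S' => G (Sum.elim S S')) (hY.snd.mono fun z hz => hz.1)
      fun S' => (hG _).mono ?_
    rintro z ⟨⟨hz, rfl⟩, rfl⟩
    exact ⟨hz, rfl⟩

/-! ### A combinatorial criterion for reducibility -/

/-- The questions in an instance of `u` are chosen among those in an instance of `t`, in such a
way that each solution of `u` answers enough of them to solve `t`. -/
def Comb (t u : BaseTerm) : Prop :=
  ∃ h : Pos u → Pos t, (∀ p, label t (h p) = label u p) ∧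
    ∀ V : Pos t → Prop, Sol u (fun p => V (h p)) → Sol t V

-- Forward, each occurrence of `u` receives the question at its image in `t`. Backward, an answered
-- occurrence of `u` answers its image, and these images suffice for `t`. Which occurrences are
-- answered is one of finitely many cases, read off from the solution by `compOn_sel`. The
-- interpretation plays no part in the two functions, so they serve a whole family.
open Classical in
theorem Comb.uRed {t u : BaseTerm} (h : Comb t u) {ι : Type} (ρ : ι → ℕ → MultiFun) :
    URed (fun i => t.interp (ρ i)) fun i => u.interp (ρ i) := by
  obtain ⟨h, hl, hs⟩ := h
  let V : (Pos u → Prop) → Pos t → Prop := fun S p => ∃ q, S q ∧ h q = p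
  let e : (Pos u → Prop) → Cantor → Pos t → Cantor := fun S y p =>
    if hp : V S p then ans u y hp.choose else Cantor.zero
  have hV : ∀ {S}, Sol u S → Sol t (V S) := fun {S} hS =>
    hs _ (hS.mono fun p hp => ⟨p, hp, rfl⟩)
  refine ⟨fun x => build u fun p => query t x (h p),
    fun x y => assemble t (V (sel u y)) x (e (sel u y) y), ?_, ?_, ?_⟩
  · exact compOn_build u fun p => compOn_query (CompOn.id _) t (h p)
  · refine compOn_sel (CompOn.id _).snd u
      (G := fun S z => assemble t (V S) z.fst (e S z.snd)) fun S => ?_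
    by_cases hS : Sol u S
    · refine compOn_assemble (CompOn.id _).fst t (hV hS) fun p hp => ?_
      simp only [e, hp, dite_true]
      exact compOn_ans (CompOn.id _).snd u _
    -- Vacuous case: the occurrences answered in a solution always suffice.
    · exact (CompOn.id _).congr fun z hz => (hS (hz.2 ▸ sol_sel)).elim
  · intro i x hx
    have hx' := mem_dom_interp.1 hx
    refine ⟨mem_dom_interp.2 fun p => ?_, fun y hy => assemble_mem hx (hV sol_sel) fun p hp => ?_⟩
    · rw [query_build, ← hl]
      exact hx' _
    · have := ans_mem hy hp.choose_spec.1
      rw [query_build, ← hl, hp.choose_spec.2] at this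
      simpa only [e, hp, dite_true] using this

theorem Comb.valid {t u : BaseTerm} (h : Comb t u) : Valid t u := fun ρ _ =>
  (h.uRed fun _ : Unit => ρ).reducible ()

theorem comb_prod_comm (t u : BaseTerm) : Comb (prod t u) (prod u t) :=
  ⟨Sum.swap, fun p => by rcases p with p | p <;> rfl, fun _ h => ⟨h.2, h.1⟩⟩

theorem comb_meet_comm (t u : BaseTerm) : Comb (meet t u) (meet u t) :=
  ⟨Sum.swap, fun p => by rcases p with p | p <;> rfl, fun _ h => h.symm⟩

theorem comb_prod_assoc (t u v : BaseTerm) : Comb (prod (prod t u) v) (prod t (prod u v)) :=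
  ⟨(Equiv.sumAssoc _ _ _).symm, fun p => by rcases p with p | p | p <;> rfl,
    fun _ h => ⟨⟨h.1, h.2.1⟩, h.2.2⟩⟩

theorem comb_prod_assoc' (t u v : BaseTerm) : Comb (prod t (prod u v)) (prod (prod t u) v) :=
  ⟨Equiv.sumAssoc _ _ _, fun p => by rcases p with (p | p) | p <;> rfl,
    fun _ h => ⟨h.1.1, h.1.2, h.2⟩⟩

theorem comb_prod_one (t : BaseTerm) : Comb t (prod t one) :=
  ⟨Sum.elim id Empty.elim, fun p => by rcases p with p | p; exacts [rfl, p.elim],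
    fun _ h => h.1⟩

theorem comb_prod_one' (t : BaseTerm) : Comb (prod t one) t :=
  ⟨Sum.inl, fun _ => rfl, fun _ h => ⟨h, trivial⟩⟩

end BaseTerm

/-! ### Weihrauch reducibility as a preorder -/

theorem MultiFun.Reducible.refl (f : MultiFun) : Reducible f f := reducible_iff.2 (URed.refl _)

theorem MultiFun.Reducible.trans {f g h : MultiFun} (h₁ : Reducible f g) (h₂ : Reducible g h) :
    Reducible f h :=
  reducible_iff.2 ((reducible_iff.1 h₁).trans (reducible_iff.1 h₂))

theorem MultiFun.Reducible.prod_mono {f f' g g' : MultiFun} (h₁ : Reducible f f') (h₂ : Reducible g g') :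
    Reducible (prod f g) (prod f' g') :=
  reducible_iff.2 ((reducible_iff.1 h₁).prod_mono (reducible_iff.1 h₂))

theorem MultiFun.Reducible.meet_mono {f f' g g' : MultiFun} (h₁ : Reducible f f') (h₂ : Reducible g g') :
    Reducible (meet f g) (meet f' g') :=
  reducible_iff.2 ((reducible_iff.1 h₁).meet_mono (reducible_iff.1 h₂))

theorem MultiFun.Reducible.join_le {f g h : MultiFun} (h₁ : Reducible f h) (h₂ : Reducible g h) :
    Reducible (join f g) h :=
  reducible_iff.2 ((reducible_iff.1 h₁).join_le (reducible_iff.1 h₂))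

theorem MultiFun.Reducible.join_mono {f f' g g' : MultiFun} (h₁ : Reducible f f') (h₂ : Reducible g g') :
    Reducible (join f g) (join f' g') :=
  reducible_iff.2 ((reducible_iff.1 h₁).join_mono (reducible_iff.1 h₂))

theorem reducible_join_left (f g : MultiFun) : Reducible f (join f g) :=
  reducible_iff.2 (URed.le_join_left _ _)

theorem reducible_join_right (f g : MultiFun) : Reducible g (join f g) :=
  reducible_iff.2 (URed.le_join_right _ _)

theorem meet_join_reducible (f g h : MultiFun) :
    Reducible (meet f (join g h)) (join (meet f g) (meet f h)) :=
  reducible_iff.2 (URed.meet_join_le _ _ _)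

theorem prod_join_reducible (f g h : MultiFun) :
    Reducible (prod f (join g h)) (join (prod f g) (prod f h)) :=
  reducible_iff.2 (URed.prod_join_le _ _ _)

theorem MultiFun.Pointed.one_reducible {f : MultiFun} (h : f.Pointed) : Reducible one f := by
  obtain ⟨c, hc, hcc⟩ := h
  exact reducible_iff.2 (URed.one_le hcc fun _ => hc)

/-- Assignment of three multivalued functions to the first three variables. -/
def assign (f g h : MultiFun) : ℕ → MultiFun
  | 0 => f
  | 1 => g
  | _ => h

theorem BaseTerm.Comb.reducible {t u : BaseTerm} (h : BaseTerm.Comb t u) (ρ : ℕ → MultiFun) :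
    Reducible (t.interp ρ) (u.interp ρ) :=
  (h.uRed fun _ : Unit => ρ).reducible ()

open BaseTerm in
theorem prod_comm_reducible (f g : MultiFun) : Reducible (f.prod g) (g.prod f) :=
  (comb_prod_comm (var 0) (var 1)).reducible (assign f g g)

open BaseTerm in
theorem meet_comm_reducible (f g : MultiFun) : Reducible (f.meet g) (g.meet f) :=
  (comb_meet_comm (var 0) (var 1)).reducible (assign f g g)

open BaseTerm in
theorem prod_assoc_reducible (f g h : MultiFun) :
    Reducible ((f.prod g).prod h) (f.prod (g.prod h)) :=
  (comb_prod_assoc (var 0) (var 1) (var 2)).reducible (assign f g h)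

open BaseTerm in
theorem reducible_prod_assoc (f g h : MultiFun) :
    Reducible (f.prod (g.prod h)) ((f.prod g).prod h) :=
  (comb_prod_assoc' (var 0) (var 1) (var 2)).reducible (assign f g h)

open BaseTerm in
theorem reducible_prod_one (f : MultiFun) : Reducible f (f.prod MultiFun.one) :=
  (comb_prod_one (var 0)).reducible (assign f f f)

open BaseTerm in
theorem prod_one_reducible (f : MultiFun) : Reducible (f.prod MultiFun.one) f :=
  (comb_prod_one' (var 0)).reducible (assign f f f)

/-! ### Sums of sequences of multivalued functions -/

namespace MultiFun

/-- The sum of a sequence of multivalued functions, with instances `0ⁿ 1 q` for instances `q` of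
the `n`-th function. -/
def sigma (F : ℕ → MultiFun) : MultiFun := fun x => {y | ∃ n q, x = tagged n q ∧ y ∈ F n q}

theorem mem_sigma_tagged {F : ℕ → MultiFun} {n : ℕ} {q y : Cantor} :
    y ∈ sigma F (tagged n q) ↔ y ∈ F n q := by
  constructor
  · rintro ⟨m, r, h, hy⟩
    have h₁ : n = m := by simpa using congrArg tagCount h
    have h₂ : q = r := by simpa using congrArg untag h
    rwa [h₁, h₂]
  · exact fun h => ⟨n, q, rfl, h⟩

theorem mem_dom_sigma_tagged {F : ℕ → MultiFun} {n : ℕ} {q : Cantor} :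
    tagged n q ∈ (sigma F).dom ↔ q ∈ (F n).dom :=
  ⟨fun ⟨y, hy⟩ => ⟨y, mem_sigma_tagged.1 hy⟩, fun ⟨y, hy⟩ => ⟨y, mem_sigma_tagged.2 hy⟩⟩

theorem exists_tagged_of_mem_dom_sigma {F : ℕ → MultiFun} {x : Cantor} (h : x ∈ (sigma F).dom) :
    ∃ n q, x = tagged n q ∧ q ∈ (F n).dom := by
  obtain ⟨y, n, q, rfl, hy⟩ := h
  exact ⟨n, q, rfl, y, hy⟩

theorem star_eq_sigma (f : MultiFun) : star f = sigma (power f) := rfl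

end MultiFun

/-- If each member of a sequence reduces to its predecessor, uniformly, then the sum of the
sequence reduces to everything above the first member. -/
theorem sigma_reducible {F : ℕ → MultiFun} {g : MultiFun} (hF : URed (fun n => F (n + 1)) F)
    (h0 : Reducible (F 0) g) : Reducible (sigma F) g := by
  obtain ⟨H, K, hH, hK, h⟩ := hF
  obtain ⟨H₀, K₀, hH₀, hK₀, h₀⟩ := reducible_iff.1 h0
  have h₀ := h₀ ()
  -- The state is a stack of questions `⟨qᵢ, ⟨qᵢ₋₁, …⟩⟩`. `S` pushes the next question. `B` acts on
  -- an answer paired with the stack: it drops the top question and turns the answer to it into an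
  -- answer to the one below.
  let S : Cantor → Cantor := fun st => Cantor.pair (H st.fst) st
  let B : Cantor → Cantor := fun st => Cantor.pair (K st.snd.snd.fst st.fst) st.snd.snd
  let E : Set Cantor := {st | ∃ n, st.fst ∈ (F (n + 1)).dom}
  let EB : Set Cantor :=
    {st | ∃ n, st.snd.snd.fst ∈ (F (n + 1)).dom ∧ st.fst ∈ F n (H st.snd.snd.fst)}
  have hS : CompOn E S := (hH.comp (CompOn.id _).fst fun st hst => hst).pair (CompOn.id _)
  have hB : CompOn EB B := by
    refine (hK.comp₂ (CompOn.id _).snd.snd.fst (CompOn.id _).fst ?_).pair (CompOn.id _).snd.snd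
    rintro st ⟨n, hn⟩
    exact ⟨n, by simpa using hn⟩
  let s : Cantor → ℕ → Cantor := fun q i => S^[i] (Cantor.pair q Cantor.zero)
  have s_succ : ∀ q i, s q (i + 1) = S (s q i) := fun q i => Function.iterate_succ_apply' _ _ _
  have hs : ∀ n q, q ∈ (F n).dom → ∀ i j, i + j = n → (s q i).fst ∈ (F j).dom := by
    intro n q hq i
    induction i with
    | zero => rintro j hj; simpa [s, ← hj] using hq
    | succ i ih =>
      rintro j hj
      rw [s_succ]
      simpa [S] using (h j _ (ih (j + 1) (by omega))).1
  -- Unwinding: after `i` of the `n` steps back, the current answer solves the question reached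
  -- after `j = n - i` steps forward, which is an instance of `F i`.
  have hb : ∀ n q, q ∈ (F n).dom → ∀ y ∈ F 0 (s q n).fst, ∀ i j, i + j = n →
      ∃ y' ∈ F i (s q j).fst, B^[i] (Cantor.pair y (s q n)) = Cantor.pair y' (s q j) := by
    intro n q hq y hy i
    induction i with
    | zero =>
      rintro j hj
      obtain rfl : j = n := by omega
      exact ⟨y, hy, rfl⟩
    | succ i ih =>
      rintro j hj
      obtain ⟨y', hy', heq⟩ := ih (j + 1) (by omega)
      rw [Function.iterate_succ_apply', heq]
      refine ⟨K (s q j).fst y', ?_, by simp [B, s_succ, S]⟩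
      refine (h i _ (hs n q hq j (i + 1) (by omega))).2 _ ?_
      simpa [s_succ, S] using hy'
  let fwd : Cantor → Cantor := fun x => S^[tagCount x] (Cantor.pair (untag x) Cantor.zero)
  have hfwd_eq : ∀ n q, fwd (tagged n q) = s q n := fun n q => by simp [fwd, s]
  have hfwd : CompOn (sigma F).dom fwd := by
    have htag : ∀ x ∈ (sigma F).dom, ∃ n q, x = tagged n q := fun x hx => by
      obtain ⟨n, q, hx, -⟩ := exists_tagged_of_mem_dom_sigma hx
      exact ⟨n, q, hx⟩
    refine hS.loop (CompOn.id _) (((CompOn.id _).untag htag).pair (CompOn.zero _)) htag ?_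
    intro x hx i hi
    obtain ⟨n, q, rfl, hq⟩ := exists_tagged_of_mem_dom_sigma hx
    simp only [tagCount_tagged, untag_tagged] at hi ⊢
    exact ⟨n - 1 - i, hs n q hq i _ (by omega)⟩
  refine reducible_iff.2 ⟨fun x => H₀ (fwd x).fst, fun x y =>
    (B^[tagCount x] (Cantor.pair (K₀ (fwd x).fst y) (fwd x))).fst, ?_, ?_, ?_⟩
  · refine hH₀.comp (hfwd.mono ?_).fst ?_
    · rintro x ⟨_, hx⟩; exact hx
    · rintro x ⟨_, hx⟩
      obtain ⟨n, q, rfl, hq⟩ := exists_tagged_of_mem_dom_sigma hx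
      exact ⟨(), by simpa [hfwd_eq] using hs n q hq n 0 (by omega)⟩
  · have hfwd' : CompOn {z : Cantor | ∃ _ : Unit, z.fst ∈ (sigma F).dom ∧
        z.snd ∈ g (H₀ (fwd z.fst).fst)} fun z => fwd z.fst :=
      hfwd.comp (CompOn.id _).fst fun _ ⟨_, hz, _⟩ => hz
    refine (hB.loop (CompOn.id _).fst
      ((hK₀.comp₂ hfwd'.fst (CompOn.id _).snd ?_).pair hfwd') ?_ ?_).fst
    · rintro z ⟨_, hz, hy⟩
      obtain ⟨n, q, hzt, hq⟩ := exists_tagged_of_mem_dom_sigma hz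
      refine ⟨(), ?_⟩
      simp only [hzt, hfwd_eq, fst_pair, snd_pair] at hy ⊢
      exact ⟨hs n q hq n 0 (by omega), hy⟩
    · rintro z ⟨_, hz, -⟩
      obtain ⟨n, q, hzt, -⟩ := exists_tagged_of_mem_dom_sigma hz
      exact ⟨n, q, hzt⟩
    · rintro z ⟨_, hz, hy⟩ i hi
      obtain ⟨n, q, hzt, hq⟩ := exists_tagged_of_mem_dom_sigma hz
      simp only [hzt, hfwd_eq, tagCount_tagged] at hy hi ⊢
      have h0' := (h₀ _ (hs n q hq n 0 (by omega))).2 _ hy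
      -- The depth `n - i` is written as a successor, possible since `i < n`, so that `s_succ` shows
      -- both the top question and the one below it.
      obtain ⟨y', hy', heq⟩ := hb n q hq _ h0' i (n - 1 - i + 1) (by omega)
      rw [heq]
      refine ⟨i, ?_⟩
      simp only [fst_pair, snd_pair, s_succ, S] at hy' ⊢
      exact ⟨hs n q hq _ _ (by omega), hy'⟩
  · rintro _ x hx
    obtain ⟨n, q, rfl, hq⟩ := exists_tagged_of_mem_dom_sigma hx
    have hd := hs n q hq n 0 (by omega)
    simp only [hfwd_eq, tagCount_tagged]
    refine ⟨(h₀ _ hd).1, fun y hy => ?_⟩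
    obtain ⟨y', hy', heq⟩ := hb n q hq _ ((h₀ _ hd).2 y hy) n 0 (by omega)
    rw [heq, mem_sigma_tagged]
    simpa [s] using hy'

/-! ### Finite parallelization -/

theorem one_reducible_star (f : MultiFun) : Reducible one (star f) :=
  reducible_iff.2 ⟨cons true, fun x _ => x, CompOn.cons' _ _, (CompOn.id _).fst, fun _ _ _ =>
    ⟨mem_dom_sigma_tagged (n := 0).2 ⟨_, rfl⟩, fun _ _ => rfl⟩⟩

/-- The instance of `f` goes to the head of the list, and the tag grows by one `0`. -/
theorem prod_star_reducible (f : MultiFun) : Reducible (prod f (star f)) (star f) := by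
  have htag : ∀ x ∈ (prod f (star f)).dom, ∃ n q, x.snd = tagged n q := fun x hx => by
    obtain ⟨n, q, h, -⟩ := exists_tagged_of_mem_dom_sigma (mem_dom_prod.1 hx).2
    exact ⟨n, q, h⟩
  refine reducible_iff.2 ⟨fun x => cons false (tagged (tagCount x.snd)
    (Cantor.pair x.fst (untag x.snd))), fun _ y => y, ?_, (CompOn.id _).snd, ?_⟩
  · have hmono : {x | ∃ _ : Unit, x ∈ (prod f (star f)).dom} ⊆ (prod f (star f)).dom :=
      fun _ ⟨_, hx⟩ => hx
    exact (((CompOn.id _).snd.tagged htag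
      ((CompOn.id _).fst.pair ((CompOn.id _).snd.untag htag))).cons false).mono hmono
  · rintro _ x hx
    obtain ⟨n, q, hxt, hq⟩ := exists_tagged_of_mem_dom_sigma (mem_dom_prod.1 hx).2
    simp only [hxt, tagCount_tagged, untag_tagged, ← tagged_succ, star_eq_sigma]
    refine ⟨mem_dom_sigma_tagged.2 (mem_dom_prod.2 ?_), fun y hy => mem_prod.2 ?_⟩
    · simpa using ⟨(mem_dom_prod.1 hx).1, hq⟩
    · have := mem_prod.1 (mem_sigma_tagged.1 hy)
      rw [hxt, mem_sigma_tagged]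
      simpa using this

-- The product `f* × g` is a sum over `n` of the products `fⁿ × g`. Absorbing one factor `f` into
-- `g` is the same reduction for all `n`, so it can be iterated.
open BaseTerm in
theorem star_prod_reducible {f g : MultiFun} (h : Reducible (prod f g) g) :
    Reducible (prod (star f) g) g := by
  have htag : ∀ x ∈ (prod (star f) g).dom, ∃ n q, x.fst = tagged n q := fun x hx => by
    obtain ⟨n, q, h, -⟩ := exists_tagged_of_mem_dom_sigma (mem_dom_prod.1 hx).1
    exact ⟨n, q, h⟩
  have h₁ : Reducible (prod (star f) g) (sigma fun n => prod (power f n) g) := by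
    refine reducible_iff.2 ⟨fun x => tagged (tagCount x.fst)
      (Cantor.pair (untag x.fst) x.snd), fun _ y => y, ?_, (CompOn.id _).snd, ?_⟩
    · have hmono : {x | ∃ _ : Unit, x ∈ (prod (star f) g).dom} ⊆ (prod (star f) g).dom :=
        fun _ ⟨_, hx⟩ => hx
      exact ((CompOn.id _).fst.tagged htag
        (((CompOn.id _).fst.untag htag).pair (CompOn.id _).snd)).mono hmono
    · rintro _ x hx
      obtain ⟨n, q, hxt, hq⟩ := exists_tagged_of_mem_dom_sigma (mem_dom_prod.1 hx).1
      simp only [hxt, tagCount_tagged, untag_tagged]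
      refine ⟨mem_dom_sigma_tagged.2 (mem_dom_prod.2 ?_), fun y hy => mem_prod.2 ?_⟩
      · simpa using ⟨hq, (mem_dom_prod.1 hx).2⟩
      · have := mem_prod.1 (mem_sigma_tagged.1 hy)
        rw [hxt, star_eq_sigma, mem_sigma_tagged]
        simpa using this
  refine h₁.trans (sigma_reducible ?_ ?_)
  · have hc : Comb (.prod (.prod (var 0) (var 1)) (var 2)) (.prod (var 1) (.prod (var 0) (var 2))) :=
      ⟨fun | .inl _ => .inl (.inr ()) | .inr (.inl _) => .inl (.inl ()) | .inr (.inr _) => .inr (),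
        by rintro (_ | _ | _) <;> rfl, fun V hV => ⟨⟨hV.2.1, hV.1⟩, hV.2.2⟩⟩
    exact (hc.uRed fun n => assign f (power f n) g).trans
      ((URed.refl fun n => power f n).prod_mono ((reducible_iff.1 h).reindex fun _ => ()))
  · refine reducible_iff.2 ⟨Cantor.snd, fun _ y => Cantor.pair Cantor.zero y, CompOn.snd' _,
      (CompOn.zero _).pair (CompOn.id _).snd, fun _ x hx => ⟨(mem_dom_prod.1 hx).2, fun y hy => ?_⟩⟩
    exact mem_prod.2 (by simpa using ⟨rfl, hy⟩)

/-- With `prod_star_reducible` and `one_reducible_star`, this makes `f*` the least degree above `1`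
that absorbs a factor `f`. -/
theorem star_reducible {f g : MultiFun} (h : Reducible (prod f g) g) (h1 : Reducible one g) :
    Reducible (star f) g :=
  (reducible_prod_one _).trans (((Reducible.refl _).prod_mono h1).trans (star_prod_reducible h))

theorem reducible_star (f : MultiFun) : Reducible f (star f) :=
  (reducible_prod_one f).trans (((Reducible.refl f).prod_mono (one_reducible_star f)).trans
    (prod_star_reducible f))

theorem MultiFun.Reducible.star_mono {f g : MultiFun} (h : Reducible f g) : Reducible (star f) (star g) :=
  star_reducible ((h.prod_mono (Reducible.refl _)).trans (prod_star_reducible g))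
    (one_reducible_star g)

theorem star_prod_star_reducible (f : MultiFun) : Reducible (prod (star f) (star f)) (star f) :=
  star_prod_reducible (prod_star_reducible f)

theorem star_star_reducible (f : MultiFun) : Reducible (star (star f)) (star f) :=
  star_reducible (star_prod_star_reducible f) (one_reducible_star f)

theorem star_one_reducible : Reducible (star one) one :=
  star_reducible (prod_one_reducible one) (Reducible.refl one)

theorem star_join_reducible (f g : MultiFun) :
    Reducible (star (join f g)) (prod (star f) (star g)) := by
  refine star_reducible ?_ ((reducible_prod_one one).trans
    ((one_reducible_star f).prod_mono (one_reducible_star g)))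
  refine (prod_comm_reducible _ _).trans ((prod_join_reducible _ _ _).trans (Reducible.join_le ?_ ?_))
  · exact (prod_comm_reducible _ _).trans ((reducible_prod_assoc _ _ _).trans
      ((prod_star_reducible f).prod_mono (Reducible.refl _)))
  · exact (prod_assoc_reducible _ _ _).trans ((Reducible.refl _).prod_mono
      ((prod_comm_reducible _ _).trans (prod_star_reducible g)))

theorem reducible_star_join (f g : MultiFun) :
    Reducible (prod (star f) (star g)) (star (join f g)) :=
  ((reducible_join_left f g).star_mono.prod_mono (reducible_join_right f g).star_mono).trans
    (star_prod_star_reducible _)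

theorem BaseTerm.comb_meet_left (t u : BaseTerm) : Comb (.meet t u) t :=
  ⟨Sum.inl, fun _ => rfl, fun _ h => Or.inl h⟩

theorem BaseTerm.comb_meet_right (t u : BaseTerm) : Comb (.meet t u) u :=
  ⟨Sum.inr, fun _ => rfl, fun _ h => Or.inr h⟩

theorem BaseTerm.comb_meet_self (t : BaseTerm) : Comb t (.meet t t) :=
  ⟨Sum.elim id id, fun p => by rcases p with p | p <;> rfl, fun _ h => h.elim id id⟩

open BaseTerm in
theorem star_meet_reducible (f g : MultiFun) :
    Reducible (star (meet f g)) (meet (star f) (star g)) :=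
  ((comb_meet_self (var 0)).reducible (assign _ f g)).trans
    (Reducible.meet_mono
      (Reducible.star_mono ((comb_meet_left (var 0) (var 1)).reducible (assign f g g)))
      (Reducible.star_mono ((comb_meet_right (var 0) (var 1)).reducible (assign f g g))))

-- The parallelization `m` serves as an accumulator. One step uses `f ⊓ (g × gⁿ) ≤ (f ⊓ gⁿ) × (f ⊓
-- g)`: the question to `f` is asked twice, and either one of the meets answers it or both parts of
-- `g × gⁿ` are answered. The new factor `f ⊓ g` is then absorbed into `m`.
open BaseTerm in
theorem meet_star_reducible (f g : MultiFun) :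
    Reducible (meet f (star g)) (star (meet f g)) := by
  let m := star (MultiFun.meet f g)
  let F : ℕ → MultiFun := fun n => .prod (.meet f (power g n)) m
  have htag : ∀ x ∈ (MultiFun.meet f (star g)).dom, ∃ n q, x.snd = tagged n q := fun x hx => by
    obtain ⟨n, q, h, -⟩ := exists_tagged_of_mem_dom_sigma (mem_dom_meet.1 hx).2
    exact ⟨n, q, h⟩
  have h₁ : Reducible (.meet f (star g)) (sigma F) := by
    -- The sequence `1 0^ω` is the instance of `m` that asks nothing, so the accumulator starts
    -- empty.
    refine reducible_iff.2 ⟨fun x => tagged (tagCount x.snd) (Cantor.pair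
      (Cantor.pair x.fst (untag x.snd)) (cons true Cantor.zero)), fun _ y => y.fst, ?_,
      (CompOn.id _).snd.fst, ?_⟩
    · have hmono : {x | ∃ _ : Unit, x ∈ (MultiFun.meet f (star g)).dom} ⊆
        (MultiFun.meet f (star g)).dom := fun _ ⟨_, hx⟩ => hx
      exact ((CompOn.id _).snd.tagged htag (((CompOn.id _).fst.pair
        ((CompOn.id _).snd.untag htag)).pair ((CompOn.zero _).cons true))).mono hmono
    · rintro _ x hx
      have hx' := mem_dom_meet.1 hx
      obtain ⟨n, q, hxt, hq⟩ := exists_tagged_of_mem_dom_sigma hx'.2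
      simp only [hxt, tagCount_tagged, untag_tagged]
      refine ⟨mem_dom_sigma_tagged.2 (mem_dom_prod.2 ⟨mem_dom_meet.2 ?_, ?_⟩), fun y hy => ?_⟩
      · simpa using ⟨hx'.1, hq⟩
      · rw [snd_pair]
        exact mem_dom_sigma_tagged (n := 0).2 ⟨_, rfl⟩
      · have := (mem_meet.1 (mem_prod.1 (mem_sigma_tagged.1 hy)).1).2
        refine mem_meet.2 ⟨hx', ?_⟩
        rw [hxt, star_eq_sigma, mem_sigma_tagged]
        simpa using this
  refine h₁.trans (sigma_reducible ?_ ?_)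
  · have hc : Comb (.prod (.meet (var 0) (.prod (var 1) (var 2))) (var 3))
        (.prod (.meet (var 0) (var 2)) (.prod (.meet (var 0) (var 1)) (var 3))) :=
      ⟨fun
        | .inl (.inl _) => .inl (.inl ())
        | .inl (.inr _) => .inl (.inr (.inr ()))
        | .inr (.inl (.inl _)) => .inl (.inl ())
        | .inr (.inl (.inr _)) => .inl (.inr (.inl ()))
        | .inr (.inr _) => .inr (),
        by rintro ((_ | _) | (_ | _) | _) <;> rfl, fun V hV =>
        ⟨hV.1.elim Or.inl fun h₂ => hV.2.1.elim Or.inl fun h₁ => Or.inr ⟨h₁, h₂⟩, hV.2.2⟩⟩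
    exact (hc.uRed fun n k => match k with
      | 0 => f
      | 1 => g
      | 2 => power g n
      | _ => m).trans ((URed.refl fun n => MultiFun.meet f (power g n)).prod_mono
        ((reducible_iff.1 (prod_star_reducible (MultiFun.meet f g))).reindex fun _ : ℕ => ()))
  -- No question to `g` is left, so the meet is solved on its right side by `0^ω`.
  · refine reducible_iff.2 ⟨Cantor.snd, fun _ y => Cantor.pair (cons true Cantor.zero) y,
      CompOn.snd' _, ((CompOn.zero _).cons true).pair (CompOn.id _).snd, fun _ x hx =>
      ⟨(mem_dom_prod.1 hx).2, fun y hy => mem_prod.2 ?_⟩⟩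
    rw [fst_pair, snd_pair]
    exact ⟨mem_meet.2 ⟨mem_dom_meet.1 (mem_dom_prod.1 hx).1, rfl⟩, hy⟩

theorem reducible_star_meet (f g : MultiFun) :
    Reducible (meet (star f) (star g)) (star (meet f g)) := by
  have h : Reducible (meet (star f) g) (star (meet f g)) :=
    (meet_comm_reducible _ _).trans ((meet_star_reducible g f).trans
      (meet_comm_reducible g f).star_mono)
  exact (meet_star_reducible _ _).trans (h.star_mono.trans (star_star_reducible _))

-- It suffices that the right-hand side absorbs `f × g`. Its member `1` is taken to the other
-- member, and there `f` goes into `f*` and `g` into `g*`.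
open BaseTerm in
theorem star_prod_le_join (f g : MultiFun) : Reducible (star (prod f g))
    (join one (prod (prod (prod f (star f)) g) (star g))) := by
  refine star_reducible ((prod_join_reducible _ _ _).trans (Reducible.join_le ?_ ?_))
    (reducible_join_left _ _)
  · refine Reducible.trans ?_ (reducible_join_right _ _)
    refine (prod_one_reducible _).trans (Reducible.trans ?_
      (((Reducible.refl _).prod_mono (one_reducible_star f)).prod_mono
        (Reducible.refl _) |>.prod_mono (one_reducible_star g)))
    exact ((reducible_prod_one f).prod_mono (Reducible.refl g)).trans (reducible_prod_one _)
  · refine Reducible.trans ?_ (reducible_join_right _ _)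
    have hc : Comb
        (.prod (.prod (var 0) (var 1)) (.prod (.prod (.prod (var 0) (var 2)) (var 1)) (var 3)))
        (.prod (.prod (.prod (var 0) (.prod (var 0) (var 2))) (var 1)) (.prod (var 1) (var 3))) :=
      ⟨fun
        | .inl (.inl (.inl _)) => .inl (.inl ())
        | .inl (.inl (.inr (.inl _))) => .inr (.inl (.inl (.inl ())))
        | .inl (.inl (.inr (.inr _))) => .inr (.inl (.inl (.inr ())))
        | .inl (.inr _) => .inl (.inr ())
        | .inr (.inl _) => .inr (.inl (.inr ()))
        | .inr (.inr _) => .inr (.inr ()),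
        by rintro (((_ | _ | _) | _) | _ | _) <;> rfl, fun V hV =>
        ⟨⟨hV.1.1.1, hV.1.2⟩, ⟨⟨hV.1.1.2.1, hV.1.1.2.2⟩, hV.2.1⟩, hV.2.2⟩⟩
    exact (hc.reducible fun
      | 0 => f
      | 1 => g
      | 2 => star f
      | _ => star g).trans ((((Reducible.refl f).prod_mono (prod_star_reducible f)).prod_mono
        (Reducible.refl g)).prod_mono (prod_star_reducible g))

/-- This is where the axioms for joins and parallelization need pointedness: `f ≤ f × g` requires `1
≤ g`. -/
theorem join_le_star_prod {f g : MultiFun} (hf : f.Pointed) (hg : g.Pointed) :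
    Reducible (join one (prod (prod (prod f (star f)) g) (star g))) (star (prod f g)) := by
  have h₁ : Reducible f (prod f g) :=
    (reducible_prod_one f).trans ((Reducible.refl f).prod_mono hg.one_reducible)
  have h₂ : Reducible g (prod f g) := (reducible_prod_one g).trans
    (((Reducible.refl g).prod_mono hf.one_reducible).trans (prod_comm_reducible g f))
  have h := star_prod_star_reducible (prod f g)
  refine Reducible.join_le (one_reducible_star _) (Reducible.trans ?_ h)
  refine Reducible.prod_mono (Reducible.trans ?_ h) h₂.star_mono
  refine Reducible.prod_mono (Reducible.trans ?_ h) (h₂.trans (reducible_star _))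
  exact Reducible.prod_mono (h₁.trans (reducible_star _)) h₁.star_mono

/-! ### Sequences of which none is computable from the others -/

namespace Cantor

/-- The `i`-th member of the list `⟨x₀, ⟨x₁, … ⟩⟩`. -/
def column : ℕ → Cantor → Cantor
  | 0, g => g.fst
  | i + 1, g => column i g.snd

/-- Replace the `i`-th member of the list `⟨x₀, ⟨x₁, … ⟩⟩` by `0^ω`. -/
def erase : ℕ → Cantor → Cantor
  | 0, g => pair zero g.snd
  | i + 1, g => pair g.fst (erase i g.snd)

/-- The place of letter `p` of the `i`-th member in the list `⟨x₀, ⟨x₁, … ⟩⟩`. -/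
def place : ℕ → ℕ → ℕ
  | 0, p => 2 * p
  | i + 1, p => 2 * place i p + 1

theorem column_apply (i p : ℕ) (g : Cantor) : column i g p = g (place i p) := by
  induction i generalizing g with
  | zero => rfl
  | succ i ih => exact ih g.snd

theorem le_place (i p : ℕ) : p ≤ place i p := by
  induction i with
  | zero => simp only [place]; omega
  | succ i ih => simp only [place]; omega

theorem erase_congr {i : ℕ} {g g' : Cantor} (h : ∀ n, (∀ p, n ≠ place i p) → g n = g' n) :
    erase i g = erase i g' := by
  induction i generalizing g g' with
  | zero =>
    have : g.snd = g'.snd := funext fun n => h _ fun p => by simp only [place]; omega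
    simp only [erase, this]
  | succ i ih =>
    have h₁ : g.fst = g'.fst := funext fun n => h _ fun p => by simp only [place]; omega
    have h₂ : erase i g.snd = erase i g'.snd := ih fun n hn => h _ fun p => by
      have := hn p
      simp only [place]; omega
    simp only [erase, h₁, h₂]

theorem column_erase {i j : ℕ} (h : j ≠ i) (g : Cantor) : column j (erase i g) = column j g := by
  induction i generalizing j g with
  | zero =>
    cases j with
    | zero => exact absurd rfl h
    | succ j => simp [column, erase]
  | succ i ih =>
    cases j with
    | zero => simp [column, erase]
    | succ j => simpa [column, erase] using ih (by omega) g.snd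

theorem continuous_pair {X : Type} [TopologicalSpace X] {F G : X → Cantor} (hF : Continuous F)
    (hG : Continuous G) : Continuous fun x => pair (F x) (G x) :=
  continuous_pi fun n => by
    unfold pair
    split_ifs
    · exact (continuous_apply _).comp hF
    · exact (continuous_apply _).comp hG

theorem continuous_fst : Continuous Cantor.fst := continuous_pi fun _ => continuous_apply _

theorem continuous_snd : Continuous Cantor.snd := continuous_pi fun _ => continuous_apply _

theorem continuous_erase (i : ℕ) : Continuous (erase i) := by
  induction i with
  | zero => exact continuous_pair continuous_const continuous_snd
  | succ i ih => exact continuous_pair continuous_fst (ih.comp continuous_snd)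

end Cantor

theorem compOn_column {D : Set Cantor} {F : Cantor → Cantor} (hF : CompOn D F) (i : ℕ) :
    CompOn D fun x => column i (F x) := by
  induction i generalizing F with
  | zero => exact hF.fst
  | succ i ih => exact ih hF.snd

/-- Diagonalization inside the cylinder of length `m` around `g₀`. If `w` puts out a letter at place
`m` for some erased `g` there, giving column `i` the opposite letter makes `w` wrong on a
neighbourhood, since erasing hides the change. Otherwise `w` never puts out letter `m` on the whole
cylinder. -/
theorem dense_interior_not_traces {w : List Bool → List Bool} (hw : WordMono w) (i : ℕ) :
    Dense (interior {g : Cantor | ¬ Traces w (erase i g) (column i g)}) := by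
  rw [(PiNat.isTopologicalBasis_cylinders fun _ : ℕ => Bool).dense_iff]
  rintro _ ⟨g₀, m, rfl⟩ -
  by_cases h : ∃ g ∈ PiNat.cylinder g₀ m, ∃ k b, (w ((erase i g).take k))[m]? = some b
  · obtain ⟨g, hg, k, b, hb⟩ := h
    let g' : Cantor := Function.update g (place i m) (!b)
    have her : erase i g' = erase i g := erase_congr fun n hn =>
      Function.update_of_ne (hn m) _ _
    refine ⟨g', fun j hj => ?_, mem_interior.2
      ⟨erase i ⁻¹' PiNat.cylinder (erase i g') k ∩ PiNat.cylinder g' (place i m + 1), ?_, ?_, ?_⟩⟩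
    -- The altered place is at least `m`, so `g'` stays in the cylinder.
    · have := le_place i m
      rw [← hg j hj]
      exact Function.update_of_ne (by omega) _ _
    · rintro g'' ⟨h₁, h₂⟩ ht
      have htake : (erase i g'').take k = (erase i g).take k := by
        rw [← her]
        exact List.map_congr_left fun j hj => h₁ j (List.mem_range.1 hj)
      obtain ⟨k', hk'⟩ := ht.apply m
      rw [column_apply, h₂ (place i m) (Nat.lt_succ_self _)] at hk'
      rw [← htake] at hb
      have e₁ := getElem?_of_prefix (hw.take_prefix (le_max_left k k')) hb
      have e₂ := getElem?_of_prefix (hw.take_prefix (le_max_right k k')) hk'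
      rw [e₁] at e₂
      simp [g'] at e₂
    · exact ((PiNat.isOpen_cylinder _ _ _).preimage (continuous_erase i)).inter
        (PiNat.isOpen_cylinder _ _ _)
    · exact ⟨PiNat.self_mem_cylinder _ _, PiNat.self_mem_cylinder _ _⟩
  · refine ⟨g₀, PiNat.self_mem_cylinder _ _, mem_interior.2
      ⟨PiNat.cylinder g₀ m, fun g hg ht => ?_, PiNat.isOpen_cylinder _ _ _,
        PiNat.self_mem_cylinder _ _⟩⟩
    obtain ⟨k, hk⟩ := ht.apply m
    exact h ⟨g, hg, k, _, hk⟩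

instance countable_computable : Countable {w : List Bool → List Bool // Computable w} := by
  have hc : ∀ w : {w : List Bool → List Bool // Computable w}, Computable fun n : ℕ =>
      Encodable.encode (w.1 ((Encodable.decode n).getD [])) := fun w =>
    Computable.encode.comp (w.2.comp (Computable.option_getD Computable.decode
      (Computable.const [])))
  refine Function.Injective.countable (β := {f : ℕ → ℕ // Computable f})
    (f := fun w => ⟨_, hc w⟩) fun v w h => Subtype.ext (funext fun σ => ?_)
  have := congrFun (congrArg Subtype.val h) (Encodable.encode σ)
  simpa using this

/-- Here `CompOn {A} fun _ => x` says that `x` is computable from `A`. There are countably many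
pairs of a column and a computable monotone word function, so by Baire some `g` defeats them all.
Its columns are the `Z k`, and `g` with column `k` erased is `A k`. -/
theorem exists_independent : ∃ Z A : ℕ → Cantor, ∀ k,
    (∀ j, j ≠ k → CompOn {A k} fun _ => Z j) ∧ ¬ CompOn {A k} fun _ => Z k := by
  have hd : Dense (⋂ p : ℕ × {w : {w : List Bool → List Bool // Computable w} // WordMono w.1},
      interior {g : Cantor | ¬ Traces p.2.1.1 (erase p.1 g) (column p.1 g)}) :=
    dense_iInter_of_isOpen (fun _ => isOpen_interior) fun p =>
      dense_interior_not_traces p.2.2 p.1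
  obtain ⟨g, hg⟩ := hd.nonempty
  rw [Set.mem_iInter] at hg
  refine ⟨fun i => column i g, fun i => erase i g, fun k => ⟨fun j hj => ?_, ?_⟩⟩
  · refine (compOn_column (CompOn.id _) j).congr ?_
    rintro _ rfl
    exact column_erase hj g
  · rintro ⟨w, hc, hm, hw⟩
    exact interior_subset (hg (k, ⟨⟨w, hc⟩, hm⟩)) (hw _ rfl)

/-! ### Formal joins of terms with starred variables -/

/-- From an assignment of the variables, the assignment that gives the value of variable `v` to
`2 v` and its finite parallelization to `2 v + 1`. -/
def starAssign (ρ : ℕ → MultiFun) (n : ℕ) : MultiFun :=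
  if n % 2 = 0 then ρ (n / 2) else star (ρ (n / 2))

/-- Nonempty finite joins of terms over `(⊓, ×, 1)`. -/
inductive JoinTerm : Type
  | base : BaseTerm → JoinTerm
  | join : JoinTerm → JoinTerm → JoinTerm

namespace JoinTerm

/-- The terms that are joined. -/
def Mem (s : BaseTerm) : JoinTerm → Prop
  | base t => s = t
  | join a b => Mem s a ∨ Mem s b

/-- The interpretation of a join of terms. -/
def interp (ρ : ℕ → MultiFun) : JoinTerm → MultiFun
  | base t => t.interp ρ
  | join a b => MultiFun.join (a.interp ρ) (b.interp ρ)

theorem exists_card_lt (a : JoinTerm) : ∃ N, ∀ s, Mem s a → Nat.card s.Pos < N := by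
  induction a with
  | base t => exact ⟨Nat.card t.Pos + 1, fun s hs => by rw [show s = t from hs]; omega⟩
  | join a b iha ihb =>
    obtain ⟨M, hM⟩ := iha
    obtain ⟨N, hN⟩ := ihb
    exact ⟨max M N, fun s hs => hs.elim (fun h => (hM s h).trans_le (le_max_left _ _))
      fun h => (hN s h).trans_le (le_max_right _ _)⟩

/-- An instance of a join is an instance of one of the joined terms. -/
theorem exists_mem_of_mem_dom {a : JoinTerm} {ρ : ℕ → MultiFun} {x : Cantor}
    (hx : x ∈ (a.interp ρ).dom) : ∃ s, Mem s a ∧ ∃ x' ∈ (s.interp ρ).dom,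
      (∀ A, CompOn {A} (fun _ => x) → CompOn {A} fun _ => x') ∧
      ∀ y' ∈ s.interp ρ x', ∃ y ∈ a.interp ρ x,
        ∀ A, CompOn {A} (fun _ => y') → CompOn {A} fun _ => y := by
  induction a generalizing x with
  | base t => exact ⟨t, rfl, x, hx, fun _ h => h, fun y hy => ⟨y, hy, fun _ h => h⟩⟩
  | join a b iha ihb =>
    have hx := mem_dom_join.1 hx
    cases hb : x 0
    · obtain ⟨s, hs, x', hx', hc, h⟩ := iha (x := x.tail) (by simpa [hb] using hx)
      refine ⟨s, Or.inl hs, x', hx', fun A hA => hc A hA.tail, fun y' hy' => ?_⟩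
      obtain ⟨y, hy, hyc⟩ := h y' hy'
      exact ⟨cons false y, mem_join.2 (by simpa [hb] using hy), fun A hA => (hyc A hA).cons _⟩
    · obtain ⟨s, hs, x', hx', hc, h⟩ := ihb (x := x.tail) (by simpa [hb] using hx)
      refine ⟨s, Or.inr hs, x', hx', fun A hA => hc A hA.tail, fun y' hy' => ?_⟩
      obtain ⟨y, hy, hyc⟩ := h y' hy'
      exact ⟨cons true y, mem_join.2 (by simpa [hb] using hy), fun A hA => (hyc A hA).cons _⟩

end JoinTerm

/-! ### An interpretation by independent sequences -/

/-- The interpretation in which question `i` to variable `v` has as its only answer the member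
`⟨v, i⟩` of the sequence `Z`. -/
noncomputable def oracleAssign (Z : ℕ → Cantor) (v : ℕ) : MultiFun := fun x =>
  {Z (Nat.pair v (tagCount x))}

/-- The list `⟨e (n - 1), ⟨… ⟨e 0, 0^ω⟩ … ⟩⟩`. -/
def nest (e : ℕ → Cantor) : ℕ → Cantor
  | 0 => Cantor.zero
  | n + 1 => Cantor.pair (e n) (nest e n)

theorem compOn_tagged {D : Set Cantor} {F : Cantor → Cantor} (hF : CompOn D F) (n : ℕ) :
    CompOn D fun x => tagged n (F x) := by
  induction n with
  | zero => exact hF.cons true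
  | succ n ih => simpa only [tagged_succ] using ih.cons false

theorem compOn_nest {D : Set Cantor} {e : ℕ → Cantor} (he : ∀ c, CompOn D fun _ => e c) (n : ℕ) :
    CompOn D fun _ => nest e n := by
  induction n with
  | zero => exact CompOn.zero D
  | succ n ih => exact (he n).pair ih

theorem exists_mem_power (Z : ℕ → Cantor) (v m : ℕ) (q : Cantor) :
    ∃ y ∈ power (oracleAssign Z v) m q, ∃ Q : Set ℕ, (∀ k ∈ Q, k.unpair.1 = v) ∧
      ∀ A, (∀ k ∈ Q, CompOn {A} fun _ => Z k) → CompOn {A} fun _ => y := by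
  induction m generalizing q with
  | zero => exact ⟨_, rfl, ∅, by simp, fun A _ => CompOn.zero _⟩
  | succ m ih =>
    obtain ⟨y, hy, Q, hQ, hc⟩ := ih q.snd
    refine ⟨Cantor.pair _ y, ⟨_, rfl, y, hy, rfl⟩,
      insert (Nat.pair v (tagCount q.fst)) Q, ?_, fun A hA => ?_⟩
    · rintro k (rfl | hk)
      · simp
      · exact hQ k hk
    · exact (hA _ (Set.mem_insert _ _)).pair (hc A fun k hk => hA k (Set.mem_insert_of_mem _ hk))

/-- A question to a variable or to its parallelization has an answer that is computable from
finitely many answers, only one if the variable is not starred. -/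
theorem exists_mem_starAssign {Z : ℕ → Cantor} {n : ℕ} {x : Cantor}
    (hx : x ∈ (starAssign (oracleAssign Z) n).dom) :
    ∃ y ∈ starAssign (oracleAssign Z) n x, ∃ Q : Set ℕ, (∀ k ∈ Q, k.unpair.1 = n / 2) ∧
      (n % 2 = 0 → Q.Subsingleton) ∧
      ∀ A, (∀ k ∈ Q, CompOn {A} fun _ => Z k) → CompOn {A} fun _ => y := by
  by_cases hn : n % 2 = 0
  · simp only [starAssign, hn, if_true]
    exact ⟨_, rfl, {Nat.pair (n / 2) (tagCount x)}, by simp, fun _ => Set.subsingleton_singleton,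
      fun A hA => hA _ rfl⟩
  · simp only [starAssign, hn, if_false] at hx ⊢
    obtain ⟨m, q, rfl, -⟩ := exists_tagged_of_mem_dom_sigma hx
    obtain ⟨y, hy, Q, hQ, hc⟩ := exists_mem_power Z (n / 2) m q
    exact ⟨y, mem_sigma_tagged.2 hy, Q, hQ, fun h => h.elim, hc⟩

theorem compOn_of_mem_power {Z : ℕ → Cantor} {v n : ℕ} {e : ℕ → Cantor} {y A : Cantor}
    (hy : y ∈ power (oracleAssign Z v) n (nest e n)) (hA : CompOn {A} fun _ => y) {c : ℕ}
    (hc : c < n) : CompOn {A} fun _ => Z (Nat.pair v (tagCount (e c))) := by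
  induction n generalizing y with
  | zero => omega
  | succ n ih =>
    obtain ⟨h₁, h₂⟩ := mem_prod.1 hy
    simp only [nest, fst_pair, snd_pair] at h₁ h₂
    rcases Nat.lt_succ_iff_lt_or_eq.1 hc with hc | rfl
    · exact ih h₂ hA.snd hc
    · exact (show y.fst = _ from h₁) ▸ hA.fst

theorem CompOn.comp_const {D : Set Cantor} {F : Cantor → Cantor} (hF : CompOn D F) {x A : Cantor}
    (hx : x ∈ D) (hA : CompOn {A} fun _ => x) : CompOn {A} fun _ => F x :=
  hF.comp hA fun _ _ => hx

open BaseTerm in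
/-- A valid inequality between a term with starred variables and a join of such terms is witnessed
by one of the joined terms and a choice of questions for it. -/
theorem exists_cover {s : BaseTerm} {a : JoinTerm}
    (h : ∀ ρ : ℕ → MultiFun, (∀ n, (ρ n).Pointed) →
      Reducible (s.interp (starAssign ρ)) (a.interp (starAssign ρ))) :
    ∃ s', a.Mem s' ∧ ∃ R : Pos s' → Set (Pos s),
      (∀ p', ∀ p ∈ R p', label s p / 2 = label s' p' / 2) ∧
      (∀ p', label s' p' % 2 = 0 → (R p').Subsingleton ∧ ∀ p ∈ R p', label s p = label s' p') ∧
      ∀ S, Sol s' S → Sol s fun p => ∃ p', S p' ∧ p ∈ R p' := by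
  obtain ⟨Z, B, hZ⟩ := exists_independent
  obtain ⟨N, hN⟩ := a.exists_card_lt
  have := finite_pos s
  obtain ⟨code, hcode⟩ := exists_injective_nat (Pos s)
  -- The tag codes both the occurrence and the copy, so that different questions have different
  -- members of `Z` as answers; `key` is the index of the answer.
  let q : Pos s → ℕ → Cantor := fun p c => tagged (Nat.pair (code p) c) Cantor.zero
  let key : Pos s → ℕ → ℕ := fun p c => Nat.pair (label s p / 2) (Nat.pair (code p) c)
  -- A starred occurrence asks `N` questions, more than any joined term has occurrences.
  let inst : Pos s → Cantor := fun p =>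
    if label s p % 2 = 0 then q p 0 else tagged N (nest (q p) N)
  let X := build s inst
  have hX : ∀ A, CompOn {A} fun _ => X := by
    intro A
    refine compOn_build s fun p => ?_
    simp only [inst]
    split_ifs
    · exact compOn_tagged (CompOn.zero _) _
    · exact compOn_tagged (compOn_nest (fun c => compOn_tagged (CompOn.zero _) _) _) _
  have hXd : X ∈ (s.interp (starAssign (oracleAssign Z))).dom := by
    refine mem_dom_interp.2 fun p => ?_
    rw [query_build]
    simp only [starAssign, inst]
    split_ifs
    · exact ⟨_, rfl⟩
    · obtain ⟨y, hy, -⟩ := exists_mem_power Z (label s p / 2) N (nest (q p) N)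
      exact mem_dom_sigma_tagged.2 ⟨y, hy⟩
  obtain ⟨H, K, hH, hK, hHK⟩ := reducible_iff.1 (h (oracleAssign Z) fun n =>
    ⟨Cantor.zero, ⟨_, rfl⟩, Computable.const false⟩)
  obtain ⟨hHd, hKm⟩ := hHK () X hXd
  obtain ⟨s', hs', x', hx', hxc, hy⟩ := JoinTerm.exists_mem_of_mem_dom hHd
  choose y hym Q hQl hQs hQc using fun p' => exists_mem_starAssign (mem_dom_interp.1 hx' p')
  have := finite_pos s'
  -- Pigeonhole: each unstarred occurrence of `s'` uses at most one member of `Z`, and there are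
  -- fewer than `N` occurrences, so some copy `c` is not used by any of them.
  obtain ⟨c, hcN, hc⟩ : ∃ c < N, ∀ p', label s' p' % 2 = 0 → ∀ k ∈ Q p',
      k.unpair.2.unpair.2 ≠ c := by
    by_contra! hcon
    choose p hp k hk hkc using hcon
    have hinj : Function.Injective fun c : Fin N => p c c.2 := by
      rintro ⟨c₁, h₁⟩ ⟨c₂, h₂⟩ heq
      have heq : p c₁ h₁ = p c₂ h₂ := heq
      have := hQs _ (hp c₁ h₁) (hk c₁ h₁) (heq ▸ hk c₂ h₂)
      exact Fin.ext ((hkc c₁ h₁).symm.trans ((congrArg (fun k => k.unpair.2.unpair.2) this).trans (hkc c₂ h₂)))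
    have hle := Nat.card_le_card_of_injective _ hinj
    have hlt := hN s' hs'
    simp only [Nat.card_fin] at hle
    omega
  let sub : Pos s → ℕ := fun p => if label s p % 2 = 0 then 0 else c
  -- An occurrence `p'` covers `p` if the answer at `p'` draws on the critical answer for `p`: copy
  -- `c` for a starred `p`, the only one otherwise.
  refine ⟨s', hs', fun p' => {p | key p (sub p) ∈ Q p'}, ?_, ?_, fun S hS => ?_⟩
  · intro p' p hp
    simpa [key] using hQl p' _ hp
  · intro p' hp'
    refine ⟨fun p₁ h₁ p₂ h₂ => ?_, fun p hp => ?_⟩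
    · have := congrArg (fun k => k.unpair.2.unpair.1) (hQs p' hp' h₁ h₂)
      exact hcode (by simpa [key] using this)
    · have h₁ : label s p / 2 = label s' p' / 2 := by simpa [key] using hQl p' _ hp
      have h₂ : label s p % 2 = 0 := by
        by_contra hne
        exact hc p' hp' _ hp (by simp [key, sub, hne])
      omega
  · obtain ⟨z, hz, hzc⟩ := hy _ (assemble_mem hx' hS fun p _ => hym p)
    have hKz := hKm z hz
    refine (sol_sel (y := K X z)).mono fun p hp => ?_
    -- If no answered `p'` covers `p`, then all answers used differ from the critical one, hence are
    -- computable from `B (key p (sub p))`. So are the solution of `s'`, the resulting solution of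
    -- `s`, and the critical answer contained in it, against independence.
    by_contra! hcon
    obtain ⟨hne, hk⟩ := hZ (key p (sub p))
    refine hk ?_
    have hx'c := hxc _ (hH.comp_const ⟨(), hXd⟩ (hX (B (key p (sub p)))))
    have hzc' := hzc (B (key p (sub p))) (compOn_assemble hx'c s' hS fun p' hp' =>
      hQc p' _ fun k hkQ => hne k fun heq => hcon p' hp' (show key p (sub p) ∈ Q p' by rwa [← heq]))
    have hKc := hK.comp_const (x := Cantor.pair X z) ⟨(), by simpa using ⟨hXd, hz⟩⟩
      ((hX _).pair hzc')
    simp only [fst_pair, snd_pair] at hKc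
    have ha := ans_mem hKz hp
    have hac := compOn_ans hKc s p
    rw [query_build] at ha
    by_cases hl : label s p % 2 = 0
    · simp only [starAssign, inst, hl, if_true] at ha
      have ha' : _ = Z _ := ha
      have hkey : Z (key p (sub p)) = Z (key p 0) := by simp [sub, hl]
      rw [ha'] at hac
      rw [hkey]
      simpa [q] using hac
    · simp only [starAssign, inst, hl, if_false] at ha
      have hkey : Z (key p (sub p)) = Z (key p c) := by simp [sub, hl]
      rw [hkey]
      simpa [q] using compOn_of_mem_power (mem_sigma_tagged.1 ha) hac hcN

/-! ### Pointedness -/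

theorem computable_pair {x y : Cantor} (hx : Computable x) (hy : Computable y) :
    Computable (Cantor.pair x y) := by
  have hdiv : Computable fun n : ℕ => n / 2 :=
    (Primrec.nat_div.comp Primrec.id (Primrec.const 2)).to_comp
  have hmod : Computable fun n : ℕ => decide (n % 2 = 0) :=
    (Primrec.eq.comp (Primrec.nat_mod.comp Primrec.id (Primrec.const 2))
      (Primrec.const 0)).decide.to_comp
  refine (Computable.cond hmod (hx.comp hdiv) (hy.comp hdiv)).of_eq fun n => ?_
  by_cases h : n % 2 = 0 <;> simp [Cantor.pair, h]

theorem computable_cons {x : Cantor} (b : Bool) (hx : Computable x) :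
    Computable (Cantor.cons b x) :=
  (Computable.nat_casesOn Computable.id (Computable.const b)
    (hx.comp Computable.snd).to₂).of_eq fun n => by cases n <;> rfl

namespace ExtTerm

theorem pointed_interp {ρ : ℕ → MultiFun} (hρ : ∀ n, (ρ n).Pointed) (t : ExtTerm) :
    (t.interp ρ).Pointed := by
  induction t with
  | var n => exact hρ n
  | one => exact ⟨Cantor.zero, ⟨_, rfl⟩, Computable.const false⟩
  | meet t u iht ihu =>
    obtain ⟨x, hx, hxc⟩ := iht
    obtain ⟨y, hy, hyc⟩ := ihu
    exact ⟨_, mem_dom_meet.2 (by simpa using ⟨hx, hy⟩), computable_pair hxc hyc⟩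
  | prod t u iht ihu =>
    obtain ⟨x, hx, hxc⟩ := iht
    obtain ⟨y, hy, hyc⟩ := ihu
    exact ⟨_, mem_dom_prod.2 (by simpa using ⟨hx, hy⟩), computable_pair hxc hyc⟩
  | join t u iht _ =>
    obtain ⟨x, hx, hxc⟩ := iht
    exact ⟨_, mem_dom_join.2 (by simpa using hx), computable_cons false hxc⟩
  | star t _ =>
    exact ⟨_, mem_dom_sigma_tagged (n := 0).2 ⟨_, rfl⟩,
      computable_cons true (Computable.const false : Computable Cantor.zero)⟩

/-! ### Soundness -/

theorem interp_subst (ρ : ℕ → MultiFun) (σ : ℕ → ExtTerm) (t : ExtTerm) :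
    (t.subst σ).interp ρ = t.interp fun n => (σ n).interp ρ := by
  induction t with
  | var n => rfl
  | one => rfl
  | meet t u iht ihu | prod t u iht ihu | join t u iht ihu => simp only [subst, interp, iht, ihu]
  | star t ih => simp only [subst, interp, ih]

theorem interp_toExt (ρ : ℕ → MultiFun) (t : BaseTerm) : t.toExt.interp ρ = t.interp ρ := by
  induction t with
  | var n => rfl
  | one => rfl
  | meet t u iht ihu | prod t u iht ihu =>
    simp only [BaseTerm.toExt, interp, BaseTerm.interp, iht, ihu]

theorem valid_of_derivable {E : Set (HornClause ExtTerm)} (hE : Sound E) {t u : ExtTerm}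
    (h : Derivable E t u) : Valid t u := by
  intro ρ hρ
  induction h with
  | refl t => exact Reducible.refl _
  | trans _ _ ih₁ ih₂ => exact ih₁.trans ih₂
  | meet_mono _ _ ih₁ ih₂ => exact ih₁.meet_mono ih₂
  | prod_mono _ _ ih₁ ih₂ => exact ih₁.prod_mono ih₂
  | join_mono _ _ ih₁ ih₂ => exact ih₁.join_mono ih₂
  | star_mono _ ih => exact ih.star_mono
  | clause c hc σ _ ih =>
    rw [interp_subst, interp_subst]
    refine hE c hc _ (fun n => pointed_interp hρ (σ n)) fun p hp => ?_
    rw [← interp_subst, ← interp_subst]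
    exact ih p hp

theorem sound_of_equation {t u : ExtTerm} (h₁ : Valid t u) (h₂ : Valid u t) :
    Sound (HornClause.equation t u) := by
  rintro _ (rfl | rfl)
  · exact fun ρ hρ _ => h₁ ρ hρ
  · exact fun ρ hρ _ => h₂ ρ hρ

theorem Sound.union {E F : Set (HornClause ExtTerm)} (hE : Sound E) (hF : Sound F) :
    Sound (E ∪ F) := fun c hc => hc.elim (hE c) (hF c)

theorem sound_joinAxioms : Sound joinAxioms := by
  refine Sound.union (Sound.union (Sound.union ?_ ?_) (sound_of_equation ?_ ?_))
    (sound_of_equation ?_ ?_)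
  · rintro _ (rfl | rfl)
    · exact fun ρ _ _ => reducible_join_left _ _
    · exact fun ρ _ _ => reducible_join_right _ _
  · rintro _ rfl ρ - h
    exact Reducible.join_le (h (var 1, var 0) (by simp)) (h (var 2, var 0) (by simp))
  · exact fun ρ _ => meet_join_reducible _ _ _
  · exact fun ρ _ => Reducible.join_le
      ((Reducible.refl _).meet_mono (reducible_join_left _ _))
      ((Reducible.refl _).meet_mono (reducible_join_right _ _))
  · exact fun ρ _ => prod_join_reducible _ _ _
  · exact fun ρ _ => Reducible.join_le
      ((Reducible.refl _).prod_mono (reducible_join_left _ _))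
      ((Reducible.refl _).prod_mono (reducible_join_right _ _))

theorem sound_starAxioms : Sound starAxioms := by
  refine Sound.union (Sound.union (Sound.union (Sound.union (Sound.union ?_ ?_)
    (sound_of_equation ?_ ?_)) (sound_of_equation ?_ ?_)) (sound_of_equation ?_ ?_))
    (sound_of_equation ?_ ?_)
  · rintro _ (rfl | rfl)
    · exact fun ρ _ _ => reducible_star _
    · exact fun ρ _ _ => star_star_reducible _
  · rintro _ rfl ρ - -
    exact star_prod_star_reducible _
  · exact fun ρ _ => star_join_reducible _ _
  · exact fun ρ _ => reducible_star_join _ _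
  · exact fun ρ _ => star_meet_reducible _ _
  · exact fun ρ _ => reducible_star_meet _ _
  · exact fun ρ _ => star_prod_le_join _ _
  · exact fun ρ hρ => join_le_star_prod (hρ 0) (hρ 1)
  · exact fun ρ _ => star_one_reducible
  · exact fun ρ _ => one_reducible_star _

/-- The axioms for `(⊓, ×, 1, ⊔, (-)*)` that extend given axioms for `(⊓, ×, 1)`. -/
def extend (Γ : Set (HornClause BaseTerm)) : Set (HornClause ExtTerm) :=
  HornClause.map BaseTerm.toExt '' Γ ∪ (joinAxioms ∪ starAxioms)

theorem sound_extend {Γ : Set (HornClause BaseTerm)} (h : BaseTerm.Sound Γ) :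
    Sound (extend Γ) := by
  refine Sound.union ?_ (sound_joinAxioms.union sound_starAxioms)
  rintro _ ⟨c, hc, rfl⟩ ρ hρ hp
  simp only [HornClause.map, interp_toExt]
  refine h c hc ρ hρ fun p hpc => ?_
  simpa only [Prod.map, interp_toExt] using hp _ (List.mem_map_of_mem hpc)

/-! ### Derivations -/

theorem toExt_subst (τ : ℕ → BaseTerm) (σ : ℕ → ExtTerm) (t : BaseTerm) :
    (t.subst τ).toExt.subst σ = t.toExt.subst fun n => (τ n).toExt.subst σ := by
  induction t with
  | var n => rfl
  | one => rfl
  | meet t u iht ihu | prod t u iht ihu =>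
    simp only [BaseTerm.subst, BaseTerm.toExt, subst, iht, ihu]

/-- Instances of clauses are closed under further substitution, so a derivation over `(⊓, ×, 1)`
survives substituting extended terms for its variables. -/
theorem derivable_of_base {Γ : Set (HornClause BaseTerm)} {t u : BaseTerm}
    (h : BaseTerm.Derivable Γ t u) (σ : ℕ → ExtTerm) :
    Derivable (extend Γ) (t.toExt.subst σ) (u.toExt.subst σ) := by
  induction h with
  | refl t => exact .refl _
  | trans _ _ ih₁ ih₂ => exact ih₁.trans ih₂
  | meet_mono _ _ ih₁ ih₂ => exact ih₁.meet_mono ih₂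
  | prod_mono _ _ ih₁ ih₂ => exact ih₁.prod_mono ih₂
  | clause c hc τ _ ih =>
    rw [toExt_subst, toExt_subst]
    refine Derivable.clause (c.map BaseTerm.toExt) (Or.inl ⟨c, hc, rfl⟩) _ fun p hp => ?_
    obtain ⟨p, hpc, rfl⟩ := List.mem_map.1 hp
    simpa only [Prod.map, toExt_subst] using ih p hpc

/-- All valid inequalities between terms over `(⊓, ×, 1)`, as axioms. -/
def validAxioms : Set (HornClause BaseTerm) :=
  {c | ∃ t u, BaseTerm.Valid t u ∧ c = HornClause.ineq t u}

theorem sound_validAxioms : BaseTerm.Sound validAxioms := by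
  rintro _ ⟨t, u, h, rfl⟩ ρ hρ -
  exact h ρ hρ

/-- Derivability from the valid inequalities over `(⊓, ×, 1)` and the axioms for joins and
parallelization. -/
abbrev Le (t u : ExtTerm) : Prop := Derivable (extend validAxioms) t u

theorem Le.valid {t u : ExtTerm} (h : Le t u) : Valid t u :=
  valid_of_derivable (sound_extend sound_validAxioms) h

/-- The only use of the completeness of `Γ`: it derives each valid inequality over `(⊓, ×, 1)` that
`Le` takes as an axiom. -/
theorem Le.derivable {Γ : Set (HornClause BaseTerm)} (hΓ : BaseTerm.Complete Γ) {t u : ExtTerm}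
    (h : Le t u) : Derivable (extend Γ) t u := by
  induction h with
  | refl t => exact .refl _
  | trans _ _ ih₁ ih₂ => exact ih₁.trans ih₂
  | meet_mono _ _ ih₁ ih₂ => exact ih₁.meet_mono ih₂
  | prod_mono _ _ ih₁ ih₂ => exact ih₁.prod_mono ih₂
  | join_mono _ _ ih₁ ih₂ => exact ih₁.join_mono ih₂
  | star_mono _ ih => exact ih.star_mono
  | clause c hc σ _ ih =>
    rcases hc with ⟨_, ⟨t, u, h, rfl⟩, rfl⟩ | hc
    · exact derivable_of_base (hΓ t u h) σ
    · exact Derivable.clause c (Or.inr hc) σ ih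

/-- The substitution of three terms for the first three variables. -/
def assignTerm (t u v : ExtTerm) : ℕ → ExtTerm
  | 0 => t
  | 1 => u
  | _ => v

theorem le_of_valid {s s' : BaseTerm} (h : BaseTerm.Valid s s') (σ : ℕ → ExtTerm) :
    Le (s.toExt.subst σ) (s'.toExt.subst σ) :=
  Derivable.clause ((HornClause.ineq s s').map BaseTerm.toExt)
    (Or.inl ⟨_, ⟨s, s', h, rfl⟩, rfl⟩) σ fun _ hp => (List.not_mem_nil hp).elim

theorem one_le (t : ExtTerm) : Le one t :=
  le_of_valid (s := .one) (s' := .var 0) (fun _ hρ => (hρ 0).one_reducible) (assignTerm t t t)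

theorem prod_comm_le (t u : ExtTerm) : Le (prod t u) (prod u t) :=
  le_of_valid (BaseTerm.comb_prod_comm (.var 0) (.var 1)).valid (assignTerm t u u)

theorem meet_comm_le (t u : ExtTerm) : Le (meet t u) (meet u t) :=
  le_of_valid (BaseTerm.comb_meet_comm (.var 0) (.var 1)).valid (assignTerm t u u)

theorem le_of_ineq_mem {t u : ExtTerm} (h : HornClause.ineq t u ∈ joinAxioms ∪ starAxioms)
    (σ : ℕ → ExtTerm) : Le (t.subst σ) (u.subst σ) :=
  Derivable.clause (HornClause.ineq t u) (Or.inr h) σ fun _ hp => (List.not_mem_nil hp).elim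

theorem le_join_left (t u : ExtTerm) : Le t (join t u) :=
  le_of_ineq_mem (t := var 0) (u := join (var 0) (var 1)) (by simp [joinAxioms])
    (assignTerm t u u)

theorem le_join_right (t u : ExtTerm) : Le u (join t u) :=
  le_of_ineq_mem (t := var 1) (u := join (var 0) (var 1)) (by simp [joinAxioms])
    (assignTerm t u u)

theorem join_le {t u v : ExtTerm} (h₁ : Le t v) (h₂ : Le u v) : Le (join t u) v := by
  refine Derivable.clause ⟨[(var 1, var 0), (var 2, var 0)], join (var 1) (var 2), var 0⟩
    (Or.inr (Or.inl (by simp [joinAxioms]))) (assignTerm v t u) fun p hp => ?_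
  simp only [List.mem_cons, List.not_mem_nil, or_false] at hp
  rcases hp with rfl | rfl
  · exact h₁
  · exact h₂

theorem meet_join_le (t u v : ExtTerm) :
    Le (meet t (join u v)) (join (meet t u) (meet t v)) :=
  le_of_ineq_mem (t := meet (var 0) (join (var 1) (var 2)))
    (u := join (meet (var 0) (var 1)) (meet (var 0) (var 2)))
    (by simp [joinAxioms, HornClause.equation]) (assignTerm t u v)

theorem prod_join_le (t u v : ExtTerm) :
    Le (prod t (join u v)) (join (prod t u) (prod t v)) :=
  le_of_ineq_mem (t := prod (var 0) (join (var 1) (var 2)))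
    (u := join (prod (var 0) (var 1)) (prod (var 0) (var 2)))
    (by simp [joinAxioms, HornClause.equation]) (assignTerm t u v)

theorem le_star (t : ExtTerm) : Le t (star t) :=
  le_of_ineq_mem (t := var 0) (u := star (var 0)) (by simp [starAxioms]) (assignTerm t t t)

theorem star_star_le (t : ExtTerm) : Le (star (star t)) (star t) :=
  le_of_ineq_mem (t := star (star (var 0))) (u := star (var 0)) (by simp [starAxioms])
    (assignTerm t t t)

theorem star_prod_star_le (t : ExtTerm) : Le (prod (star t) (star t)) (star t) :=
  le_of_ineq_mem (t := prod (star (var 0)) (star (var 0))) (u := star (var 0))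
    (by simp [starAxioms]) (assignTerm t t t)

/-- Derivable equality. -/
def Eqv (t u : ExtTerm) : Prop := Le t u ∧ Le u t

namespace Eqv

theorem refl (t : ExtTerm) : Eqv t t := ⟨.refl t, .refl t⟩

theorem trans {t u v : ExtTerm} (h₁ : Eqv t u) (h₂ : Eqv u v) : Eqv t v :=
  ⟨h₁.1.trans h₂.1, h₂.2.trans h₁.2⟩

theorem meet {t t' u u' : ExtTerm} (h₁ : Eqv t t') (h₂ : Eqv u u') :
    Eqv (meet t u) (meet t' u') := ⟨h₁.1.meet_mono h₂.1, h₁.2.meet_mono h₂.2⟩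

theorem prod {t t' u u' : ExtTerm} (h₁ : Eqv t t') (h₂ : Eqv u u') :
    Eqv (prod t u) (prod t' u') := ⟨h₁.1.prod_mono h₂.1, h₁.2.prod_mono h₂.2⟩

theorem join {t t' u u' : ExtTerm} (h₁ : Eqv t t') (h₂ : Eqv u u') :
    Eqv (join t u) (join t' u') := ⟨h₁.1.join_mono h₂.1, h₁.2.join_mono h₂.2⟩

theorem star {t t' : ExtTerm} (h : Eqv t t') : Eqv (star t) (star t') :=
  ⟨h.1.star_mono, h.2.star_mono⟩

theorem of_equation_subset {t u : ExtTerm}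
    (h : HornClause.equation t u ⊆ joinAxioms ∪ starAxioms) (σ : ℕ → ExtTerm) :
    Eqv (t.subst σ) (u.subst σ) :=
  ⟨le_of_ineq_mem (h (Or.inl rfl)) σ, le_of_ineq_mem (h (Or.inr rfl)) σ⟩

theorem meet_join (t u v : ExtTerm) :
    Eqv (.meet t (.join u v)) (.join (.meet t u) (.meet t v)) :=
  ⟨meet_join_le t u v, join_le ((Derivable.refl t).meet_mono (le_join_left u v))
    ((Derivable.refl t).meet_mono (le_join_right u v))⟩

theorem prod_join (t u v : ExtTerm) :
    Eqv (.prod t (.join u v)) (.join (.prod t u) (.prod t v)) :=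
  ⟨prod_join_le t u v, join_le ((Derivable.refl t).prod_mono (le_join_left u v))
    ((Derivable.refl t).prod_mono (le_join_right u v))⟩

theorem meet_comm (t u : ExtTerm) : Eqv (.meet t u) (.meet u t) :=
  ⟨meet_comm_le t u, meet_comm_le u t⟩

theorem prod_comm (t u : ExtTerm) : Eqv (.prod t u) (.prod u t) :=
  ⟨prod_comm_le t u, prod_comm_le u t⟩

theorem star_star (t : ExtTerm) : Eqv (.star (.star t)) (.star t) :=
  ⟨star_star_le t, le_star _⟩

theorem star_join (t u : ExtTerm) : Eqv (.star (.join t u)) (.prod (.star t) (.star u)) :=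
  of_equation_subset (t := .star (.join (var 0) (var 1)))
    (u := .prod (.star (var 0)) (.star (var 1)))
    (by rintro c hc; simp only [starAxioms, Set.mem_union, hc, true_or, or_true])
    (assignTerm t u u)

theorem star_meet (t u : ExtTerm) : Eqv (.star (.meet t u)) (.meet (.star t) (.star u)) :=
  of_equation_subset (t := .star (.meet (var 0) (var 1)))
    (u := .meet (.star (var 0)) (.star (var 1)))
    (by rintro c hc; simp only [starAxioms, Set.mem_union, hc, true_or, or_true])
    (assignTerm t u u)

theorem star_prod (t u : ExtTerm) : Eqv (.star (.prod t u))
    (.join .one (.prod (.prod (.prod t (.star t)) u) (.star u))) :=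
  of_equation_subset (t := .star (.prod (var 0) (var 1)))
    (u := .join .one (.prod (.prod (.prod (var 0) (.star (var 0))) (var 1)) (.star (var 1))))
    (by rintro c hc; simp only [starAxioms, Set.mem_union, hc, true_or, or_true])
    (assignTerm t u u)

theorem star_one : Eqv (.star .one) .one :=
  of_equation_subset (t := .star .one) (u := .one)
    (by rintro c hc; simp only [starAxioms, Set.mem_union, hc, or_true])
    (assignTerm .one .one .one)

end Eqv

/-! ### Normal forms -/

/-- The substitution of variable `v` for `2 v` and of its parallelization for `2 v + 1`. -/
def starSubst (n : ℕ) : ExtTerm := if n % 2 = 0 then var (n / 2) else star (var (n / 2))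

/-- The term over `(⊓, ×, 1)` in variables and starred variables. -/
abbrev ofBase (s : BaseTerm) : ExtTerm := s.toExt.subst starSubst

/-- The join of terms in variables and starred variables. -/
def ofJoin : JoinTerm → ExtTerm
  | .base s => ofBase s
  | .join a b => join (ofJoin a) (ofJoin b)

theorem interp_ofBase (ρ : ℕ → MultiFun) (s : BaseTerm) :
    (ofBase s).interp ρ = s.interp (starAssign ρ) := by
  rw [interp_subst, interp_toExt]
  congr 1
  funext n
  simp only [starSubst, starAssign]
  split_ifs <;> rfl

theorem interp_ofJoin (ρ : ℕ → MultiFun) (a : JoinTerm) :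
    (ofJoin a).interp ρ = a.interp (starAssign ρ) := by
  induction a with
  | base s => exact interp_ofBase ρ s
  | join a b iha ihb => simp only [ofJoin, interp, JoinTerm.interp, iha, ihb]

/-- The terms that are derivably equal to a join of terms in variables and starred variables. -/
def HasNormalForm (t : ExtTerm) : Prop := ∃ a, Eqv t (ofJoin a)

theorem HasNormalForm.of_eqv {t u : ExtTerm} (h : Eqv t u) (hu : HasNormalForm u) :
    HasNormalForm t := by
  obtain ⟨a, ha⟩ := hu
  exact ⟨a, h.trans ha⟩

theorem HasNormalForm.join {t u : ExtTerm} (ht : HasNormalForm t) (hu : HasNormalForm u) :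
    HasNormalForm (join t u) := by
  obtain ⟨a, ha⟩ := ht
  obtain ⟨b, hb⟩ := hu
  exact ⟨.join a b, ha.join hb⟩

theorem hasNormalForm_ofBase (s : BaseTerm) : HasNormalForm (ofBase s) := ⟨.base s, Eqv.refl _⟩

theorem HasNormalForm.meet {t u : ExtTerm} (ht : HasNormalForm t) (hu : HasNormalForm u) :
    HasNormalForm (meet t u) := by
  obtain ⟨a, ha⟩ := ht
  obtain ⟨b, hb⟩ := hu
  refine .of_eqv (ha.meet hb) ?_
  clear ha hb
  induction a with
  | join a₁ a₂ ih₁ ih₂ =>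
    exact .of_eqv (((Eqv.meet_comm _ _).trans (Eqv.meet_join _ _ _)).trans
      ((Eqv.meet_comm _ _).join (Eqv.meet_comm _ _))) (ih₁.join ih₂)
  | base s =>
    induction b with
    | base s' => exact hasNormalForm_ofBase (.meet s s')
    | join b₁ b₂ ih₁ ih₂ => exact .of_eqv (Eqv.meet_join _ _ _) (ih₁.join ih₂)

theorem HasNormalForm.prod {t u : ExtTerm} (ht : HasNormalForm t) (hu : HasNormalForm u) :
    HasNormalForm (prod t u) := by
  obtain ⟨a, ha⟩ := ht
  obtain ⟨b, hb⟩ := hu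
  refine .of_eqv (ha.prod hb) ?_
  clear ha hb
  induction a with
  | join a₁ a₂ ih₁ ih₂ =>
    exact .of_eqv (((Eqv.prod_comm _ _).trans (Eqv.prod_join _ _ _)).trans
      ((Eqv.prod_comm _ _).join (Eqv.prod_comm _ _))) (ih₁.join ih₂)
  | base s =>
    induction b with
    | base s' => exact hasNormalForm_ofBase (.prod s s')
    | join b₁ b₂ ih₁ ih₂ => exact .of_eqv (Eqv.prod_join _ _ _) (ih₁.join ih₂)

/-- The star moves inwards through `1`, `⊓` and `×`. The equation for `(a × b)*` brings in a join,
but its members are built from terms whose normal forms are at hand. -/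
theorem hasNormalForm_star_ofBase (s : BaseTerm) : HasNormalForm (star (ofBase s)) := by
  induction s with
  | var n =>
    -- Both `v`, coded by `2 v`, and `v*`, coded by `2 v + 1`, have parallelization `v*`.
    have h : ofBase (.var (2 * (n / 2) + 1)) = star (var (n / 2)) := by
      have h₁ : (2 * (n / 2) + 1) % 2 = 1 := by omega
      have h₂ : (2 * (n / 2) + 1) / 2 = n / 2 := by omega
      simp [ofBase, BaseTerm.toExt, subst, starSubst, h₁, h₂]
    refine .of_eqv ?_ (hasNormalForm_ofBase (.var (2 * (n / 2) + 1)))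
    rw [h]
    simp only [ofBase, BaseTerm.toExt, subst, starSubst]
    split_ifs
    · exact Eqv.refl _
    · exact Eqv.star_star _
  | one => exact .of_eqv Eqv.star_one (hasNormalForm_ofBase .one)
  | meet s s' ih ih' => exact .of_eqv (Eqv.star_meet _ _) (ih.meet ih')
  | prod s s' ih ih' =>
    exact .of_eqv (Eqv.star_prod _ _) ((hasNormalForm_ofBase .one).join
      ((((hasNormalForm_ofBase s).prod ih).prod (hasNormalForm_ofBase s')).prod ih'))

theorem HasNormalForm.star {t : ExtTerm} (ht : HasNormalForm t) : HasNormalForm (star t) := by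
  obtain ⟨a, ha⟩ := ht
  refine .of_eqv ha.star ?_
  clear ha
  induction a with
  | base s => exact hasNormalForm_star_ofBase s
  | join a b iha ihb => exact .of_eqv (Eqv.star_join _ _) (iha.prod ihb)

theorem hasNormalForm (t : ExtTerm) : HasNormalForm t := by
  induction t with
  | var n =>
    refine .of_eqv ?_ (hasNormalForm_ofBase (.var (2 * n)))
    simpa [ofBase, BaseTerm.toExt, subst, starSubst] using Eqv.refl (var n)
  | one => exact hasNormalForm_ofBase .one
  | meet t u iht ihu => exact iht.meet ihu
  | prod t u iht ihu => exact iht.prod ihu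
  | join t u iht ihu => exact iht.join ihu
  | star t ih => exact ih.star

/-! ### Completeness -/

theorem le_ofJoin_of_mem {s : BaseTerm} {a : JoinTerm} (h : a.Mem s) : Le (ofBase s) (ofJoin a) := by
  induction a with
  | base t => rw [show s = t from h]; exact .refl _
  | join a b iha ihb =>
    exact h.elim (fun h => (iha h).trans (le_join_left _ _))
      fun h => (ihb h).trans (le_join_right _ _)

open BaseTerm (Pos Sol label) in
/-- Starred variables are above all finite products of copies of the variable, starred or not. -/
theorem exists_prod_le_star {s : BaseTerm} {v : ℕ} {R : Set (Pos s)} (hfin : R.Finite)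
    (hR : ∀ p ∈ R, label s p / 2 = v) :
    ∃ (u : BaseTerm) (h : Pos u → Pos s), (∀ p, label s (h p) = label u p) ∧
      Le (ofBase u) (star (var v)) ∧
      ∀ V : Pos s → Prop, Sol u (fun p => V (h p)) → ∀ p ∈ R, V p := by
  induction R, hfin using Set.Finite.induction_on with
  | empty => exact ⟨.one, fun p => p.elim, fun p => p.elim, one_le _, by simp⟩
  | @insert p R _ _ ih =>
    obtain ⟨u, h, hl, hle, hs⟩ := ih fun p hp => hR p (Set.mem_insert_of_mem _ hp)
    refine ⟨.prod (.var (label s p)) u, Sum.elim (fun _ => p) h, ?_, ?_, fun V hV => ?_⟩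
    · rintro (q | q)
      · rfl
      · exact hl q
    · refine Derivable.trans (Derivable.prod_mono ?_ hle) (star_prod_star_le _)
      have hp := hR p (Set.mem_insert _ _)
      simp only [BaseTerm.toExt, subst, starSubst, hp]
      split_ifs
      · exact le_star _
      · exact .refl _
    · rintro q (rfl | hq)
      · exact hV.1
      · exact hs V hV.2 q hq

-- The term `u` is `s'` with each starred variable replaced by the product of the letters it covers,
-- and each unstarred variable replaced by `1` if it covers nothing. All replacements go down in the
-- order, so monotonicity gives `u ≤ s'`, and solving `u` answers everything covered by some
-- sufficient set of occurrences of `s'`.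
open BaseTerm (Pos Sol label) in
theorem exists_le_ofBase {s s' : BaseTerm} {R : Pos s' → Set (Pos s)}
    (hstar : ∀ p', ∀ p ∈ R p', label s p / 2 = label s' p' / 2)
    (hvar : ∀ p', label s' p' % 2 = 0 →
      (R p').Subsingleton ∧ ∀ p ∈ R p', label s p = label s' p') :
    ∃ (u : BaseTerm) (h : Pos u → Pos s), (∀ p, label s (h p) = label u p) ∧
      Le (ofBase u) (ofBase s') ∧
      ∀ V : Pos s → Prop, Sol u (fun p => V (h p)) → Sol s' fun p' => ∀ p ∈ R p', V p := by
  induction s' with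
  | var n =>
    by_cases hn : n % 2 = 0
    · obtain ⟨hsub, hl⟩ := hvar () hn
      rcases hsub.eq_empty_or_singleton with hR | ⟨p, hR⟩
      · exact ⟨.one, fun p => p.elim, fun p => p.elim, one_le _, fun V _ p hp => by
          rw [hR] at hp; exact hp.elim⟩
      · refine ⟨.var n, fun _ => p, fun _ => hl p (by rw [hR]; rfl), .refl _, fun V hV q hq => ?_⟩
        rw [hR] at hq
        exact (show q = p from hq) ▸ hV
    · have := BaseTerm.finite_pos s
      obtain ⟨u, h, hl, hle, hs⟩ := exists_prod_le_star (R := R ()) (Set.toFinite _) (hstar ())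
      refine ⟨u, h, hl, ?_, hs⟩
      have : ofBase (.var n) = star (var (n / 2)) := by
        simp [ofBase, BaseTerm.toExt, subst, starSubst, hn]
      rw [this]
      exact hle
  | one => exact ⟨.one, fun p => p.elim, fun p => p.elim, .refl _, fun _ _ => trivial⟩
  | meet t t' ih ih' =>
    obtain ⟨u, h, hl, hle, hs⟩ := ih (R := fun p => R (Sum.inl p)) (fun p => hstar (Sum.inl p))
      fun p => hvar (Sum.inl p)
    obtain ⟨u', h', hl', hle', hs'⟩ := ih' (R := fun p => R (Sum.inr p))
      (fun p => hstar (Sum.inr p)) fun p => hvar (Sum.inr p)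
    exact ⟨.meet u u', Sum.elim h h', fun p => p.rec hl hl', hle.meet_mono hle',
      fun V hV => hV.imp (hs V) (hs' V)⟩
  | prod t t' ih ih' =>
    obtain ⟨u, h, hl, hle, hs⟩ := ih (R := fun p => R (Sum.inl p)) (fun p => hstar (Sum.inl p))
      fun p => hvar (Sum.inl p)
    obtain ⟨u', h', hl', hle', hs'⟩ := ih' (R := fun p => R (Sum.inr p))
      (fun p => hstar (Sum.inr p)) fun p => hvar (Sum.inr p)
    exact ⟨.prod u u', Sum.elim h h', fun p => p.rec hl hl', hle.prod_mono hle',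
      fun V hV => ⟨hs V hV.1, hs' V hV.2⟩⟩

/-- The chain is `s ≤ u ≤ s' ≤ a`. In the first step `v` and `v*` count as unrelated variables, so
it is an instance of a valid inequality over `(⊓, ×, 1)`; how they are related matters only in the
second. -/
theorem le_of_valid_ofBase {s : BaseTerm} {a : JoinTerm} (h : Valid (ofBase s) (ofJoin a)) :
    Le (ofBase s) (ofJoin a) := by
  obtain ⟨s', hs', R, hstar, hvar, hsol⟩ := exists_cover (s := s) (a := a) fun ρ hρ => by
    rw [← interp_ofBase, ← interp_ofJoin]
    exact h ρ hρ
  obtain ⟨u, g, hl, hle, hs⟩ := exists_le_ofBase hstar hvar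
  have hc : BaseTerm.Comb s u := ⟨g, hl, fun V hV =>
    (hsol _ (hs V hV)).mono fun p ⟨_, hV, hp⟩ => hV p hp⟩
  exact (le_of_valid hc.valid starSubst).trans (hle.trans (le_ofJoin_of_mem hs'))

theorem le_of_valid_ofJoin {a b : JoinTerm} (h : Valid (ofJoin a) (ofJoin b)) :
    Le (ofJoin a) (ofJoin b) := by
  induction a with
  | base s => exact le_of_valid_ofBase h
  | join a₁ a₂ ih₁ ih₂ =>
    exact join_le (ih₁ fun ρ hρ => (reducible_join_left _ _).trans (h ρ hρ))
      (ih₂ fun ρ hρ => (reducible_join_right _ _).trans (h ρ hρ))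

/-- Validity is carried to the normal forms by soundness of `validAxioms`, so `Γ` need not be sound.
Only the finished derivation is translated to `Γ`. -/
theorem complete_extend {Γ : Set (HornClause BaseTerm)} (hΓ : BaseTerm.Complete Γ) :
    Complete (extend Γ) := by
  intro t u h
  obtain ⟨a, hta, hat⟩ := hasNormalForm t
  obtain ⟨b, hub, hbu⟩ := hasNormalForm u
  have hab : Le (ofJoin a) (ofJoin b) := le_of_valid_ofJoin fun ρ hρ =>
    (Le.valid hat ρ hρ).trans ((h ρ hρ).trans (Le.valid hub ρ hρ))
  exact Le.derivable hΓ (hta.trans (hab.trans hbu))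

end ExtTerm

end Weihrauch

theorem proposition19 (Γ : Set (Weihrauch.HornClause Weihrauch.BaseTerm))
    (hΓ : Weihrauch.BaseTerm.Complete Γ) :
    Weihrauch.ExtTerm.Complete
      (Weihrauch.HornClause.map Weihrauch.BaseTerm.toExt '' Γ ∪
        (Weihrauch.ExtTerm.joinAxioms ∪ Weihrauch.ExtTerm.starAxioms)) ∧
    (Weihrauch.BaseTerm.Sound Γ →
      Weihrauch.ExtTerm.Sound
        (Weihrauch.HornClause.map Weihrauch.BaseTerm.toExt '' Γ ∪
          (Weihrauch.ExtTerm.joinAxioms ∪ Weihrauch.ExtTerm.starAxioms))) :=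
  ⟨Weihrauch.ExtTerm.complete_extend hΓ, Weihrauch.ExtTerm.sound_extend⟩
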